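/- All graphs are finite and loopless; parallel edges are allowed. A connected graph with at least four vertices is \emph{matching covered} if each of its edges belongs to a perfect matching, and a matching covered graph is \emph{minimal} if deleting any edge results in a graph that is not matching covered. A graph is \emph{obtained from a tree $T$ by isomorphic leaf matching} if it is (up to isomorphism) obtained from the disjoint union of $T$ and a copy $T'$ of $T$ by adding, for each leaf $v$ of $T$, one edge joining $v$ to the corresponding leaf $\varphi(v)$ of $T'$, where $\varphi\colon T\to T'$ is a fixed isomorphism. \textbf{Theorem.} Let $G$ be a graph with $n$ vertices. Then $G$ is a minimal bipartite matching covered graph with exactly $\frac{3n-6}{2}$ edges if and only if $G$ is obtained from a star $K_{1,p}$, for some $p\geq 2$, by isomorphic leaf matching. -/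

import Mathlib

open scoped Graph

namespace SimpleGraph

/-- A leaf is a vertex of degree one. -/
def IsLeaf {V : Type*} (T : SimpleGraph V) (v : V) : Prop := ∃! w, T.Adj v w

/-- The graph obtained from the disjoint union of `T` and its copy `T'` by joining each leaf of
`T` with the leaf of `T'` that corresponds to it under the isomorphism `φ`. -/
def isoLeafMatching {V W : Type*} (T : SimpleGraph V) (T' : SimpleGraph W) (φ : T ≃g T') :
    SimpleGraph (V ⊕ W) :=
  (T ⊕g T') ⊔
    SimpleGraph.fromRel fun a b => ∃ v, T.IsLeaf v ∧ a = Sum.inl v ∧ b = Sum.inr (φ v)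

end SimpleGraph

namespace Graph

/-- A multigraph is bipartite if its vertex set is partitioned into two color classes such that
each edge has one end in each of them. -/
def IsBipartite {α β : Type*} (G : Graph α β) : Prop :=
  ∃ A B : Set α, Disjoint A B ∧ A ∪ B = V(G) ∧
    ∀ ⦃e x y⦄, G.IsLink e x y → (x ∈ A ∧ y ∈ B) ∨ (x ∈ B ∧ y ∈ A)

/-- A matching is a set of edges, none of them a loop, no two of which share an end. -/
def IsMatching {α β : Type*} (G : Graph α β) (M : Set β) : Prop :=
  M ⊆ E(G) ∧ (∀ e ∈ M, ∀ x, ¬ G.IsLoopAt e x) ∧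
    ∀ e ∈ M, ∀ f ∈ M, ∀ x, G.Inc e x → G.Inc f x → e = f

/-- A perfect matching is a matching that covers every vertex. -/
def IsPerfectMatching {α β : Type*} (G : Graph α β) (M : Set β) : Prop :=
  G.IsMatching M ∧ ∀ x ∈ V(G), ∃ e ∈ M, G.Inc e x

/-- A graph is matching covered if it is connected, has at least four vertices, and each of its
edges belongs to a perfect matching. -/
def IsMatchingCovered {α β : Type*} (G : Graph α β) : Prop :=
  G.toSimpleGraph.Connected ∧ 4 ≤ V(G).ncard ∧
    ∀ e ∈ E(G), ∃ M, G.IsPerfectMatching M ∧ e ∈ M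

/-- A matching covered graph is minimal if the deletion of any edge results in a graph that is not
matching covered. -/
def IsMinimalMatchingCovered {α β : Type*} (G : Graph α β) : Prop :=
  G.IsMatchingCovered ∧ ∀ e ∈ E(G), ¬ (G.deleteEdges {e}).IsMatchingCovered

/-- A minimal bipartite matching covered graph is edge extremal if it has `(3n - 6) / 2` edges,
where `n` is the number of its vertices. -/
def IsEdgeExtremal {α β : Type*} (G : Graph α β) : Prop :=
  (E(G).ncard : ℚ) = (3 * (V(G).ncard : ℚ) - 6) / 2

/-- Isomorphism of multigraphs: bijections of the vertices and of the edges that preserve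
incidence. -/
def IsIsomorphic {α β α' β' : Type*} (G : Graph α β) (H : Graph α' β') : Prop :=
  ∃ (f : V(G) ≃ V(H)) (g : E(G) ≃ E(H)),
    ∀ (e : E(G)) (x y : V(G)), G.IsLink e x y ↔ H.IsLink (g e) (f x) (f y)

/-- `G` is, up to isomorphism, obtained from `T` by isomorphic leaf matching, that is, from `T`
and a disjoint copy `T'` of `T` by joining corresponding leaves. -/
def IsObtainedByIsoLeafMatching {α β V : Type*} (G : Graph α β) (T : SimpleGraph V) : Prop :=
  ∃ (T' : SimpleGraph V) (φ : T ≃g T'),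
    G.IsIsomorphic (Graph.ofSimpleGraph (T.isoLeafMatching T' φ))

end Graph

/-! A bipartite graph with at least two vertices in one color class is matching covered exactly when
the adjacency relation between its classes is elementary, i.e. satisfies Hall's condition with a
surplus on nonempty proper subsets. Contracting a perfect matching `σ` turns this into strong
connectivity of the digraph on the left class with an arc from `z` to `u` when `(z, σ u)` is a pair
(`Elementary.eq_of_closed`, `elementary_of_closed`). Minimality excludes parallel edges, so the
problem becomes one about minimal elementary relations (`isMinimalMatchingCovered_iff`). With `m`
vertices in each class, the extremal number of edges is `3 m - 3`.

For `m ≥ 2`, such a relation is a smaller minimal one plus an ear (`MinimalElementary.exists_ear`).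
An ear with `k ≥ 1` new vertices in each class adds `2 k + 1 ≤ 3 k` pairs, with equality only for `k
= 1`, so the bound propagates by induction. Starting from a single pair, one ear gives a cycle, and
among cycles with `m ≥ 3` only the hexagon is extremal. The four-cycle is never an intermediate
stage: the ends of an ear in a minimal relation are nonadjacent, whereas the four-cycle is complete
bipartite.

In the extremal case the last ear therefore has `k = 1` and is attached to an extremal relation, by
induction a double star. If it joins the centers, both stars grow by one leaf. Otherwise, with at
least four left vertices, a rerouted ear makes some pair redundant
(`IsDoubleStar.not_minimalElementary_union`); in a hexagon, the ends of the ear can themselves be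
taken as centers. Conversely, a double star with `m ≥ 3` is minimal because each of its pairs has an
end of degree two, the least degree possible in an elementary relation. -/

open Finset

/-! ### Elementary relations: Hall's condition with surplus, and strong connectivity -/

namespace BipartiteRelation

variable {A B : Type*} [DecidableEq A] [DecidableEq B]

/-- The set of right ends of pairs of `R` whose left end lies in `Z`. -/
def neighbors (R : Finset (A × B)) (Z : Finset A) : Finset B :=
  (R.filter fun e => e.1 ∈ Z).image Prod.snd

theorem mem_neighbors {R : Finset (A × B)} {Z : Finset A} {b : B} :
    b ∈ neighbors R Z ↔ ∃ a ∈ Z, (a, b) ∈ R := by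
  simp only [neighbors, mem_image, mem_filter, Prod.exists, exists_eq_right]
  exact exists_congr fun a => and_comm

theorem neighbors_mono {R R' : Finset (A × B)} (h : R ⊆ R') (Z : Finset A) :
    neighbors R Z ⊆ neighbors R' Z :=
  image_subset_image (filter_subset_filter _ h)

/-- A bipartite relation with color classes `X` and `Y` of the same size is elementary if it
satisfies Hall's condition, with strict inequality for nonempty proper subsets of `X`. -/
structure Elementary (X : Finset A) (Y : Finset B) (R : Finset (A × B)) : Prop where
  subset : R ⊆ X ×ˢ Y
  card_eq : #X = #Y
  hall : ∀ Z ⊆ X, #Z ≤ #(neighbors R Z)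
  hall_strict : ∀ Z ⊆ X, Z.Nonempty → Z ≠ X → #Z < #(neighbors R Z)

/-- An elementary relation is minimal if it does not stay elementary when a pair is removed. -/
def MinimalElementary (X : Finset A) (Y : Finset B) (R : Finset (A × B)) : Prop :=
  Elementary X Y R ∧ ∀ e ∈ R, ¬ Elementary X Y (R.erase e)

/-- A perfect matching contained in the relation `R`, as a function on the left color class. -/
def IsMatchingMap (X : Finset A) (Y : Finset B) (R : Finset (A × B)) (σ : A → B) : Prop :=
  Set.BijOn σ X Y ∧ ∀ x ∈ X, (x, σ x) ∈ R

variable {X : Finset A} {Y : Finset B} {R R' : Finset (A × B)}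

theorem Elementary.mono (h : Elementary X Y R) (hR : R ⊆ R') (hR' : R' ⊆ X ×ˢ Y) :
    Elementary X Y R' where
  subset := hR'
  card_eq := h.card_eq
  hall Z hZ := (h.hall Z hZ).trans (card_le_card (neighbors_mono hR Z))
  hall_strict Z hZ hne hX := (h.hall_strict Z hZ hne hX).trans_le
    (card_le_card (neighbors_mono hR Z))

theorem MinimalElementary.eq_of_subset (h : MinimalElementary X Y R) (hR : R' ⊆ R)
    (h' : Elementary X Y R') : R' = R := by
  by_contra hne
  obtain ⟨e, he, he'⟩ := exists_of_ssubset (hR.ssubset_of_ne hne)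
  exact h.2 e he (h'.mono (subset_erase.2 ⟨hR, he'⟩) ((erase_subset _ _).trans h.1.subset))

/-- After `a` and `b` are removed, the surplus of one on nonempty proper subsets pays for the loss
of `b`, so Hall's theorem matches the remaining vertices. -/
theorem Elementary.exists_matchingMap_apply_eq (h : Elementary X Y R) {a : A} {b : B}
    (hab : (a, b) ∈ R) : ∃ σ, IsMatchingMap X Y R σ ∧ σ a = b := by
  have haX : a ∈ X := (mem_product.1 (h.subset hab)).1
  have hbY : b ∈ Y := (mem_product.1 (h.subset hab)).2
  let t : {x // x ∈ X.erase a} → Finset B := fun x => (neighbors R {x.1}).erase b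
  have hall : ∀ s : Finset {x // x ∈ X.erase a}, #s ≤ #(s.biUnion t) := by
    intro s
    rcases s.eq_empty_or_nonempty with rfl | hs
    · simp
    set Z := s.map (Function.Embedding.subtype _) with hZ
    have hZX : Z ⊆ X.erase a := by
      intro z hz
      obtain ⟨x, _, rfl⟩ := mem_map.1 hz
      exact x.2
    have h1 : #Z < #(neighbors R Z) := h.hall_strict Z (hZX.trans (erase_subset _ _))
      (by simpa [hZ] using hs) (fun h => by
        have := hZX (h ▸ haX : a ∈ Z)
        simp at this)
    have h2 : (neighbors R Z).erase b ⊆ s.biUnion t := by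
      intro y hy
      obtain ⟨hyb, hy⟩ := mem_erase.1 hy
      obtain ⟨z, hz, hxy⟩ := mem_neighbors.1 hy
      obtain ⟨x, hx, rfl⟩ := mem_map.1 hz
      refine mem_biUnion.2 ⟨x, hx, mem_erase.2 ⟨hyb, mem_neighbors.2 ⟨x, by simp, hxy⟩⟩⟩
    have h3 : #Z = #s := card_map _
    have h4 := card_le_card h2
    have h5 := pred_card_le_card_erase (s := neighbors R Z) (a := b)
    omega
  obtain ⟨f, hf, hft⟩ := (Finset.all_card_le_biUnion_card_iff_exists_injective t).1 hall
  have hft' : ∀ x, f x ≠ b ∧ (x.1, f x) ∈ R := by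
    intro x
    have := hft x
    simp only [t, mem_erase, mem_neighbors, mem_singleton, exists_eq_left] at this
    exact this
  let σ : A → B := fun x => if hx : x ∈ X.erase a then f ⟨x, hx⟩ else b
  have hσa : σ a = b := by simp [σ]
  have hσ : ∀ x (hx : x ∈ X.erase a), σ x = f ⟨x, hx⟩ := fun x hx => by simp only [σ, dif_pos hx]
  have hσR : ∀ x ∈ X, (x, σ x) ∈ R := by
    intro x hx
    by_cases hxa : x = a
    · rw [hxa, hσa]; exact hab
    · rw [hσ x (mem_erase.2 ⟨hxa, hx⟩)]; exact (hft' ⟨x, _⟩).2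
  have hinj : Set.InjOn σ X := by
    intro x hx y hy hxy
    by_cases hxa : x = a <;> by_cases hya : y = a
    · rw [hxa, hya]
    · rw [hxa, hσa, hσ y (mem_erase.2 ⟨hya, hy⟩)] at hxy
      exact ((hft' _).1 hxy.symm).elim
    · rw [hya, hσa, hσ x (mem_erase.2 ⟨hxa, hx⟩)] at hxy
      exact ((hft' _).1 hxy).elim
    · rw [hσ y (mem_erase.2 ⟨hya, hy⟩), hσ x (mem_erase.2 ⟨hxa, hx⟩)] at hxy
      exact congrArg Subtype.val (hf hxy)
  have hmaps : Set.MapsTo σ X Y := fun x hx => (mem_product.1 (h.subset (hσR x hx))).2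
  exact ⟨σ, ⟨⟨hmaps, hinj, surjOn_of_injOn_of_card_le σ hmaps hinj h.card_eq.ge⟩, hσR⟩, hσa⟩

theorem Elementary.exists_matchingMap (h : Elementary X Y R) (hX : X.Nonempty) :
    ∃ σ, IsMatchingMap X Y R σ := by
  obtain ⟨x, hx⟩ := hX
  have := h.hall {x} (by simpa using hx)
  obtain ⟨y, hy⟩ := card_pos.1 ((by simp : 0 < #({x} : Finset A)).trans_le this)
  obtain ⟨a, _, hay⟩ := mem_neighbors.1 hy
  obtain ⟨σ, hσ, -⟩ := h.exists_matchingMap_apply_eq hay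
  exact ⟨σ, hσ⟩

/-- A set closed under the arcs of the contracted digraph has all its neighbors in its image under
`σ`, hence no surplus. This is strong connectivity, and the form in which elementarity is used
below. -/
theorem Elementary.eq_of_closed (h : Elementary X Y R) {σ : A → B} (hσ : IsMatchingMap X Y R σ)
    {Z : Finset A} (hZX : Z ⊆ X) (hZ : Z.Nonempty)
    (hcl : ∀ z ∈ Z, ∀ u ∈ X, (z, σ u) ∈ R → u ∈ Z) : Z = X := by
  by_contra hne
  have h1 := h.hall_strict Z hZX hZ hne
  have h2 : neighbors R Z ⊆ Z.image σ := by
    intro y hy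
    obtain ⟨a, ha, hay⟩ := mem_neighbors.1 hy
    obtain ⟨u, hu, rfl⟩ := hσ.1.surjOn (mem_product.1 (h.subset hay)).2
    exact mem_image_of_mem _ (hcl a ha u hu hay)
  exact absurd h1 ((card_le_card h2).trans card_image_le).not_gt

/-- The neighbors of `Z` always include `σ(Z)`, which gives Hall's condition; if there are no
others, then `Z` is closed. -/
theorem elementary_of_closed (hR : R ⊆ X ×ˢ Y) {σ : A → B} (hσ : IsMatchingMap X Y R σ)
    (hcl : ∀ Z ⊆ X, Z.Nonempty → (∀ z ∈ Z, ∀ u ∈ X, (z, σ u) ∈ R → u ∈ Z) → Z = X) :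
    Elementary X Y R := by
  have himg : ∀ Z ⊆ X, Z.image σ ⊆ neighbors R Z := by
    intro Z hZ y hy
    obtain ⟨z, hz, rfl⟩ := mem_image.1 hy
    exact mem_neighbors.2 ⟨z, hz, hσ.2 z (hZ hz)⟩
  have hcard : ∀ Z ⊆ X, #(Z.image σ) = #Z := fun Z hZ =>
    card_image_of_injOn (hσ.1.injOn.mono (by exact_mod_cast hZ))
  refine ⟨hR, ?_, fun Z hZ => (hcard Z hZ).symm.le.trans (card_le_card (himg Z hZ)), ?_⟩
  · exact Finset.card_nbij σ hσ.1.mapsTo hσ.1.injOn hσ.1.surjOn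
  · intro Z hZ hne hX
    rw [← hcard Z hZ]
    refine card_lt_card ((himg Z hZ).ssubset_of_ne fun heq => hX (hcl Z hZ hne ?_))
    intro z hz u hu hzu
    obtain ⟨z', hz', hzz⟩ := mem_image.1 (heq ▸ mem_neighbors.2 ⟨z, hz, hzu⟩ : σ u ∈ Z.image σ)
    exact hσ.1.injOn (hZ hz') hu hzz ▸ hz'

theorem Elementary.exists_right_ne (h : Elementary X Y R) (hX : 2 ≤ #X) {x : A} (hx : x ∈ X)
    (b : B) : ∃ y ≠ b, (x, y) ∈ R := by
  have h1 := h.hall_strict {x} (by simpa using hx) (by simp) (by rintro rfl; simp at hX)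
  rw [card_singleton] at h1
  obtain ⟨y, hy, hyb⟩ := exists_mem_ne h1 b
  obtain ⟨a, ha, hay⟩ := mem_neighbors.1 hy
  exact ⟨y, hyb, mem_singleton.1 ha ▸ hay⟩

/-- The condition is stated on the left side only, so for right vertices it is applied to `X`
without `a`: if `a` were the only possible neighbor of `y`, this set would miss `y` and have no
surplus. -/
theorem Elementary.exists_left_ne (h : Elementary X Y R) (hX : 2 ≤ #X) {y : B} (hy : y ∈ Y)
    {a : A} (ha : a ∈ X) : ∃ x ≠ a, (x, y) ∈ R := by
  by_contra! hcon
  have hc : #(X.erase a) = #X - 1 := card_erase_of_mem ha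
  have h1 := h.hall_strict (X.erase a) (erase_subset _ _) (card_pos.1 (by omega))
    (by rw [ne_eq, erase_eq_self]; exact fun h => h ha)
  have h2 : neighbors R (X.erase a) ⊆ Y.erase y := by
    intro z hz
    obtain ⟨x, hx, hxz⟩ := mem_neighbors.1 hz
    refine mem_erase.2 ⟨?_, (mem_product.1 (h.subset hxz)).2⟩
    rintro rfl
    exact hcon x (mem_erase.1 hx).1 hxz
  have h3 := card_le_card h2
  rw [card_erase_of_mem hy] at h3
  have := h.card_eq
  omega

end BipartiteRelation

/-! ### Ears and the ear decomposition of minimal elementary relations -/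

namespace BipartiteRelation

variable {A B : Type*} [DecidableEq A] [DecidableEq B]

/-- The pairs of the path `w 0, v 1, w 1, v 2, …, v k, w k, v (k + 1)`. -/
def earPairs (k : ℕ) (w : ℕ → A) (v : ℕ → B) : Finset (A × B) :=
  (range (k + 1)).image (fun i => (w i, v (i + 1))) ∪
    (range k).image fun i => (w (i + 1), v (i + 1))

theorem mem_earPairs {k : ℕ} {w : ℕ → A} {v : ℕ → B} {e : A × B} :
    e ∈ earPairs k w v ↔ (∃ i ≤ k, e = (w i, v (i + 1))) ∨
      ∃ i < k, e = (w (i + 1), v (i + 1)) := by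
  simp only [earPairs, mem_union, mem_image, mem_range, Nat.lt_succ_iff, eq_comm]

/-- The inner vertices `f 1, …, f k`. -/
def inner {C : Type*} [DecidableEq C] (k : ℕ) (f : ℕ → C) : Finset C :=
  (range k).image fun i => f (i + 1)

theorem mem_inner {C : Type*} [DecidableEq C] {k : ℕ} {f : ℕ → C} {c : C} :
    c ∈ inner k f ↔ ∃ i < k, c = f (i + 1) := by
  simp only [inner, mem_image, mem_range, eq_comm]

/-- The path `w 0, v 1, w 1, v 2, …, v k, w k, v (k + 1)` is an ear for the color classes `S` and
`T`: its ends lie in `S` and `T`, and its inner vertices are distinct and outside of them. -/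
structure IsEar (S : Finset A) (T : Finset B) (k : ℕ) (w : ℕ → A) (v : ℕ → B) : Prop where
  pos : 0 < k
  left_mem : w 0 ∈ S
  right_mem : v (k + 1) ∈ T
  left_notMem : ∀ i < k, w (i + 1) ∉ S
  right_notMem : ∀ i < k, v (i + 1) ∉ T
  left_inj : ∀ i < k, ∀ j < k, w (i + 1) = w (j + 1) → i = j
  right_inj : ∀ i < k, ∀ j < k, v (i + 1) = v (j + 1) → i = j

variable {S : Finset A} {T : Finset B} {k : ℕ} {w : ℕ → A} {v : ℕ → B} {R₀ : Finset (A × B)}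

theorem IsEar.earPairs_subset (h : IsEar S T k w v) :
    earPairs k w v ⊆ (S ∪ inner k w) ×ˢ (T ∪ inner k v) := by
  have hw : ∀ i ≤ k, w i ∈ S ∪ inner k w := by
    rintro (_ | i) hi
    · exact mem_union_left _ h.left_mem
    · exact mem_union_right _ (mem_inner.2 ⟨i, hi, rfl⟩)
  have hv : ∀ i ≤ k, v (i + 1) ∈ T ∪ inner k v := by
    intro i hi
    rcases hi.eq_or_lt with rfl | hi
    · exact mem_union_left _ h.right_mem
    · exact mem_union_right _ (mem_inner.2 ⟨i, hi, rfl⟩)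
  intro e he
  rcases mem_earPairs.1 he with ⟨i, hi, rfl⟩ | ⟨i, hi, rfl⟩
  · exact mem_product.2 ⟨hw i hi, hv i hi⟩
  · exact mem_product.2 ⟨hw (i + 1) hi, hv i hi.le⟩

omit [DecidableEq B] in
theorem IsEar.card_union_inner (h : IsEar S T k w v) : #(S ∪ inner k w) = #S + k := by
  rw [card_union_of_disjoint, inner, card_image_of_injOn, card_range]
  · intro i hi j hj hij
    exact h.left_inj i (by simpa using hi) j (by simpa using hj) hij
  · rw [disjoint_right]
    intro x hx
    obtain ⟨i, hi, rfl⟩ := mem_inner.1 hx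
    exact h.left_notMem i hi

/-- Since `k` is positive, each pair of the ear has an inner end, so all `2 * k + 1` of them are
new. -/
theorem IsEar.card_union_earPairs (h : IsEar S T k w v) (hR₀ : R₀ ⊆ S ×ˢ T) :
    #(R₀ ∪ earPairs k w v) = #R₀ + (2 * k + 1) := by
  have hw : ∀ i ≤ k, ∀ j ≤ k, w i = w j → i = j := by
    rintro (_ | i) hi (_ | j) hj hij
    · rfl
    · exact (h.left_notMem j hj (hij ▸ h.left_mem)).elim
    · exact (h.left_notMem i hi (hij ▸ h.left_mem)).elim
    · rw [h.left_inj i hi j hj hij]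
  rw [card_union_of_disjoint, earPairs, card_union_of_disjoint, card_image_of_injOn,
    card_image_of_injOn, card_range, card_range]
  · ring
  · intro i hi j hj hij
    exact h.left_inj i (by simpa using hi) j (by simpa using hj) (congrArg Prod.fst hij)
  · intro i hi j hj hij
    simp only [coe_range, Set.mem_Iio] at hi hj
    exact hw i (by omega) j (by omega) (congrArg Prod.fst hij)
  · rw [disjoint_left]
    intro e he he'
    obtain ⟨i, hi, rfl⟩ := mem_image.1 he
    obtain ⟨j, hj, hij⟩ := mem_image.1 he'
    simp only [mem_range] at hi hj
    obtain ⟨h1, h2⟩ := Prod.mk.inj hij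
    obtain rfl := hw (j + 1) hj i (by omega) h1
    rcases (show j + 1 < k ∨ j + 1 = k by omega) with hk | hk
    · have := h.right_inj j hj (j + 1) hk h2
      omega
    · apply h.right_notMem j hj
      rw [h2, hk]
      exact h.right_mem
  · rw [disjoint_left]
    intro e he he'
    obtain ⟨h1, h2⟩ := mem_product.1 (hR₀ he)
    rcases mem_earPairs.1 he' with ⟨i, hi, rfl⟩ | ⟨i, hi, rfl⟩
    · rcases i with _ | i
      · exact h.right_notMem 0 h.pos h2
      · exact h.left_notMem i hi h1
    · exact h.left_notMem i hi h1

/-- Adding an ear to a relation with a perfect matching gives an elementary relation if joining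
the ends of the ear by a single pair does. -/
theorem IsEar.elementary_union (h : IsEar S T k w v) (hR₀ : R₀ ⊆ S ×ˢ T) {σ : A → B}
    (hσ : IsMatchingMap S T R₀ σ) (hel : Elementary S T (insert (w 0, v (k + 1)) R₀)) :
    Elementary (S ∪ inner k w) (T ∪ inner k v) (R₀ ∪ earPairs k w v) := by
  -- Matching `w (i + 1)` with `v (i + 1)` makes the ear a directed path `w 0, w 1, …, w k, t` in
  -- the contracted digraph, where `t` is the partner of `v (k + 1)`.
  have hex : ∃ τ : A → B, (∀ x ∈ S, τ x = σ x) ∧ ∀ i < k, τ (w (i + 1)) = v (i + 1) := by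
    classical
    refine ⟨fun x => if x ∈ S then σ x else if hx : ∃ i < k, x = w (i + 1) then
      v (hx.choose + 1) else σ x, fun x hx => if_pos hx, fun i hi => ?_⟩
    have hx : ∃ j < k, w (i + 1) = w (j + 1) := ⟨i, hi, rfl⟩
    simp only [if_neg (h.left_notMem i hi), dif_pos hx]
    exact congrArg (fun n => v (n + 1)) (h.left_inj i hi _ hx.choose_spec.1 hx.choose_spec.2).symm
  obtain ⟨τ, hτS, hτw⟩ := hex
  have hsub : R₀ ∪ earPairs k w v ⊆ (S ∪ inner k w) ×ˢ (T ∪ inner k v) :=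
    union_subset (hR₀.trans (product_subset_product subset_union_left subset_union_left))
      h.earPairs_subset
  have hτR : ∀ x ∈ S ∪ inner k w, (x, τ x) ∈ R₀ ∪ earPairs k w v := by
    intro x hx
    rcases mem_union.1 hx with hx | hx
    · rw [hτS x hx]
      exact mem_union_left _ (hσ.2 x hx)
    · obtain ⟨i, hi, rfl⟩ := mem_inner.1 hx
      rw [hτw i hi]
      exact mem_union_right _ (mem_earPairs.2 (Or.inr ⟨i, hi, rfl⟩))
  have hτ : IsMatchingMap (S ∪ inner k w) (T ∪ inner k v) (R₀ ∪ earPairs k w v) τ := by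
    refine ⟨⟨fun x hx => (mem_product.1 (hsub (hτR x hx))).2, ?_, ?_⟩, hτR⟩
    · intro x hx y hy hxy
      rw [mem_coe, mem_union, mem_inner] at hx hy
      rcases hx with hx | ⟨i, hi, rfl⟩ <;> rcases hy with hy | ⟨j, hj, rfl⟩
      · rw [hτS x hx, hτS y hy] at hxy
        exact hσ.1.injOn hx hy hxy
      · rw [hτS x hx, hτw j hj] at hxy
        exact (h.right_notMem j hj (hxy ▸ hσ.1.mapsTo hx)).elim
      · rw [hτS y hy, hτw i hi] at hxy
        exact (h.right_notMem i hi (hxy ▸ hσ.1.mapsTo hy)).elim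
      · rw [hτw i hi, hτw j hj] at hxy
        rw [h.right_inj i hi j hj hxy]
    · intro y hy
      rw [mem_coe, mem_union, mem_inner] at hy
      rcases hy with hy | ⟨i, hi, rfl⟩
      · obtain ⟨x, hx, rfl⟩ := hσ.1.surjOn hy
        exact ⟨x, mem_coe.2 (mem_union_left _ hx), hτS x hx⟩
      · exact ⟨w (i + 1), mem_coe.2 (mem_union_right _ (mem_inner.2 ⟨i, hi, rfl⟩)), hτw i hi⟩
  obtain ⟨t, ht, htv⟩ := hσ.1.surjOn h.right_mem
  have ht : t ∈ S := ht
  refine elementary_of_closed hsub hτ fun Z hZ hne hcl => ?_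
  have hforward : ∀ n ≤ k, ∀ i ≤ n, w i ∈ Z → w n ∈ Z := by
    intro n
    induction n with
    | zero => intro _ i hi hiZ; rwa [Nat.le_zero.1 hi] at hiZ
    | succ n ih =>
      intro hn i hi hiZ
      rcases hi.eq_or_lt with rfl | hi
      · exact hiZ
      · refine hcl (w n) (ih (by omega) i (by omega) hiZ) _
          (mem_union_right _ (mem_inner.2 ⟨n, hn, rfl⟩)) ?_
        rw [hτw n hn]
        exact mem_union_right _ (mem_earPairs.2 (Or.inl ⟨n, by omega, rfl⟩))
  have hend : ∀ i ≤ k, w i ∈ Z → t ∈ Z := by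
    intro i hi hiZ
    refine hcl (w k) (hforward k le_rfl i hi hiZ) t (mem_union_left _ ht) ?_
    rw [hτS t ht, htv]
    exact mem_union_right _ (mem_earPairs.2 (Or.inl ⟨k, le_rfl, rfl⟩))
  have hne' : (Z ∩ S).Nonempty := by
    obtain ⟨z, hz⟩ := hne
    rcases mem_union.1 (hZ hz) with hzS | hzw
    · exact ⟨z, mem_inter.2 ⟨hz, hzS⟩⟩
    · obtain ⟨i, hi, rfl⟩ := mem_inner.1 hzw
      exact ⟨t, mem_inter.2 ⟨hend (i + 1) hi hz, ht⟩⟩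
  -- Inside `S` the ear acts as one arc from `w 0` to `t`, which is what the pair `(w 0, v (k + 1))`
  -- contributes in `hel`.
  have hS : Z ∩ S = S := by
    refine hel.eq_of_closed ⟨hσ.1, fun x hx => mem_insert_of_mem (hσ.2 x hx)⟩
      inter_subset_right hne' ?_
    intro z hz u hu hzu
    obtain ⟨hzZ, hzS⟩ := mem_inter.1 hz
    refine mem_inter.2 ⟨?_, hu⟩
    rcases mem_insert.1 hzu with heq | hzu
    · obtain ⟨rfl, h2⟩ := Prod.mk.inj heq
      rw [← htv] at h2
      rw [hσ.1.injOn hu ht h2]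
      exact hend 0 (Nat.zero_le _) hzZ
    · refine hcl z hzZ u (mem_union_left _ hu) ?_
      rw [hτS u hu]
      exact mem_union_left _ hzu
  rw [inter_eq_right] at hS
  refine hZ.antisymm (union_subset hS fun x hx => ?_)
  obtain ⟨i, hi, rfl⟩ := mem_inner.1 hx
  exact hforward (i + 1) hi 0 (Nat.zero_le _) (hS h.left_mem)

/-- The ear can replace a pair joining its ends, so such a pair would be redundant. -/
theorem IsEar.notMem_of_minimalElementary (h : IsEar S T k w v) (hel : Elementary S T R₀)
    (hS : 2 ≤ #S)
    (hmin : MinimalElementary (S ∪ inner k w) (T ∪ inner k v) (R₀ ∪ earPairs k w v)) :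
    (w 0, v (k + 1)) ∉ R₀ := by
  intro hmem
  -- A perfect matching that sends `w 0` to another neighbor survives the removal of the pair.
  obtain ⟨y, hy, hay⟩ := hel.exists_right_ne hS h.left_mem (v (k + 1))
  obtain ⟨σ, hσ, hσa⟩ := hel.exists_matchingMap_apply_eq hay
  have hsub : R₀.erase (w 0, v (k + 1)) ⊆ R₀ := erase_subset _ _
  have hσ' : IsMatchingMap S T (R₀.erase (w 0, v (k + 1))) σ := by
    refine ⟨hσ.1, fun x hx => mem_erase.2 ⟨fun heq => ?_, hσ.2 x hx⟩⟩
    obtain ⟨rfl, h2⟩ := Prod.mk.inj heq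
    exact hy (hσa.symm.trans h2)
  have h1 := h.elementary_union (hsub.trans hel.subset) hσ' (by rwa [insert_erase hmem])
  have h2 := hmin.eq_of_subset (union_subset_union_left hsub) h1
  have h3 := h.card_union_earPairs (hsub.trans hel.subset)
  rw [h2, h.card_union_earPairs hel.subset, card_erase_of_mem hmem] at h3
  have := card_pos.2 ⟨_, hmem⟩
  omega

/-- A pair redundant in `R₀` stays redundant once the ear is added. -/
theorem IsEar.minimalElementary_of_union (h : IsEar S T k w v) (hel : Elementary S T R₀)
    (hmin : MinimalElementary (S ∪ inner k w) (T ∪ inner k v) (R₀ ∪ earPairs k w v)) :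
    MinimalElementary S T R₀ := by
  refine ⟨hel, fun e he hel' => ?_⟩
  have hsub : R₀.erase e ⊆ R₀ := erase_subset _ _
  obtain ⟨σ, hσ⟩ := hel'.exists_matchingMap ⟨_, h.left_mem⟩
  have h1 := h.elementary_union (hsub.trans hel.subset) hσ (hel'.mono (subset_insert _ _)
    (insert_subset (mem_product.2 ⟨h.left_mem, h.right_mem⟩) hel'.subset))
  have h2 := hmin.eq_of_subset (union_subset_union_left hsub) h1
  have h3 := h.card_union_earPairs (hsub.trans hel.subset)
  rw [h2, h.card_union_earPairs hel.subset, card_erase_of_mem he] at h3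
  have := card_pos.2 ⟨_, he⟩
  omega

/-- A shortest walk that leaves `S` and returns to it, in the digraph obtained from an elementary
relation by contracting a perfect matching. -/
theorem Elementary.exists_walk {X : Finset A} {Y : Finset B} {R : Finset (A × B)}
    (h : Elementary X Y R) {σ : A → B} (hσ : IsMatchingMap X Y R σ) (hSX : S ⊆ X)
    (hS : S.Nonempty) (hne : S ≠ X) :
    ∃ (k : ℕ) (w : ℕ → A), 0 < k ∧ w 0 ∈ S ∧ w (k + 1) ∈ S ∧ (∀ i < k, w (i + 1) ∉ S) ∧
      (∀ i < k, ∀ j < k, w (i + 1) = w (j + 1) → i = j) ∧ (∀ i ≤ k + 1, w i ∈ X) ∧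
      ∀ i ≤ k, (w i, σ (w (i + 1))) ∈ R := by
  classical
  -- Walks with `k + 1` arcs whose first arc leaves `S`. Some exist, as `S` is not closed; their
  -- ends form a closed set, hence all of `X`, so some walk returns to `S`.
  let P : ℕ → (ℕ → A) → Prop := fun k w => w 0 ∈ S ∧ w 1 ∉ S ∧ (∀ i ≤ k + 1, w i ∈ X) ∧
    ∀ i ≤ k, (w i, σ (w (i + 1))) ∈ R
  have hex : ∃ k, ∃ w, P k w ∧ w (k + 1) ∈ S := by
    let Z := X.filter fun z => ∃ k w, P k w ∧ w (k + 1) = z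
    have hZ : Z = X := by
      refine h.eq_of_closed hσ (filter_subset _ _) ?_ ?_
      · by_contra hempty
        refine hne (h.eq_of_closed hσ hSX hS fun s hs u hu hsu => ?_)
        by_contra huS
        refine hempty ⟨u, mem_filter.2 ⟨hu, 0, fun i => if i = 0 then s else u,
          ⟨hs, huS, ?_, ?_⟩, rfl⟩⟩
        · intro i _
          dsimp only
          split_ifs
          exacts [hSX hs, hu]
        · intro i hi
          obtain rfl := Nat.le_zero.1 hi
          exact hsu
      · intro z hz u hu hzu
        obtain ⟨_, k, w, ⟨h0, h1, hX, hR⟩, rfl⟩ := mem_filter.1 hz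
        refine mem_filter.2 ⟨hu, k + 1, fun i => if i ≤ k + 1 then w i else u,
          ⟨by simpa using h0, by simpa using h1, ?_, ?_⟩, by simp⟩
        · intro i _
          dsimp only
          split_ifs with hi
          exacts [hX i hi, hu]
        · intro i hi
          dsimp only
          rw [if_pos hi]
          split_ifs with hi'
          · exact hR i (by omega)
          · obtain rfl : i = k + 1 := by omega
            exact hzu
    obtain ⟨s, hs⟩ := hS
    obtain ⟨_, k, w, hP, rfl⟩ := mem_filter.1 (hZ ▸ hSX hs : s ∈ Z)
    exact ⟨k, w, hP, hs⟩
  obtain ⟨w, ⟨h0, h1, hX, hR⟩, hk⟩ := Nat.find_spec hex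
  have hmin : ∀ m < Nat.find hex, ∀ w, P m w → w (m + 1) ∉ S :=
    fun m hm w hP hw => Nat.find_min hex hm ⟨w, hP, hw⟩
  generalize Nat.find hex = k at *
  have hout : ∀ i < k, w (i + 1) ∉ S := fun i hi =>
    hmin i hi w ⟨h0, h1, fun j hj => hX j (by omega), fun j hj => hR j (by omega)⟩
  -- Cutting out the closed subwalk between two equal vertices keeps `w 0` and `w 1` and gives a
  -- shorter returning walk.
  have hinj : ∀ i j, i < j → j < k → w (i + 1) ≠ w (j + 1) := by
    intro i j hij hj heq
    refine hmin (k - (j - i)) (by omega) (fun n => if n ≤ i + 1 then w n else w (n + (j - i)))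
      ⟨by simpa using h0, by simpa using h1, ?_, ?_⟩ ?_
    · intro n hn
      dsimp only
      split_ifs
      exacts [hX n (by omega), hX _ (by omega)]
    · intro n hn
      dsimp only
      split_ifs with h2 h3 h3
      · exact hR n (by omega)
      · obtain rfl : n = i + 1 := by omega
        rw [heq, show i + 1 + 1 + (j - i) = j + 1 + 1 by omega]
        exact hR _ (by omega)
      · omega
      · rw [show n + 1 + (j - i) = n + (j - i) + 1 by omega]
        exact hR _ (by omega)
    · rw [if_neg (by omega), show k - (j - i) + 1 + (j - i) = k + 1 by omega]
      exact hk
  refine ⟨k, w, ?_, h0, hk, hout, ?_, hX, hR⟩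
  · rcases k with _ | k
    · exact (h1 hk).elim
    · omega
  · intro i hi j hj heq
    rcases lt_trichotomy i j with hij | hij | hij
    · exact (hinj i j hij hj heq).elim
    · exact hij
    · exact (hinj j i hij hi heq.symm).elim

/-- A minimal elementary relation with at least two left vertices arises from a smaller one by
adding an ear. -/
theorem MinimalElementary.exists_ear {X : Finset A} {Y : Finset B} {R : Finset (A × B)}
    (h : MinimalElementary X Y R) (hX : 2 ≤ #X) :
    ∃ (S : Finset A) (T : Finset B) (R₀ : Finset (A × B)) (k : ℕ) (w : ℕ → A) (v : ℕ → B),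
      IsEar S T k w v ∧ MinimalElementary S T R₀ ∧ X = S ∪ inner k w ∧ Y = T ∪ inner k v ∧
      R = R₀ ∪ earPairs k w v := by
  classical
  obtain ⟨x₀, hx₀⟩ : X.Nonempty := card_pos.1 (by omega)
  obtain ⟨σ, hσ⟩ := h.1.exists_matchingMap ⟨x₀, hx₀⟩
  let r : Finset A → Finset (A × B) := fun S => R ∩ S ×ˢ S.image σ
  have hrσ : ∀ S ⊆ X, IsMatchingMap S (S.image σ) (r S) σ := by
    intro S hS
    refine ⟨?_, fun x hx => mem_inter.2 ⟨hσ.2 x (hS hx),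
      mem_product.2 ⟨hx, mem_image_of_mem _ hx⟩⟩⟩
    rw [coe_image]
    exact (hσ.1.injOn.mono (by exact_mod_cast hS)).bijOn_image
  -- The ear is attached to a largest proper part, closed under `σ`-partners, on which `R` is still
  -- elementary. By maximality the ear exhausts `X`, and by minimality no pair of `R` is left over.
  let F := X.powerset.filter fun S => S.Nonempty ∧ S ≠ X ∧ Elementary S (S.image σ) (r S)
  have hF : F.Nonempty := by
    refine ⟨{x₀}, mem_filter.2 ⟨mem_powerset.2 (by simpa using hx₀), by simp, ?_, ?_⟩⟩
    · rintro rfl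
      simp at hX
    · refine elementary_of_closed inter_subset_right (hrσ _ (by simpa using hx₀)) ?_
      intro Z hZ hne _
      exact (subset_singleton_iff.1 hZ).resolve_left hne.ne_empty
  obtain ⟨S, hSF, hmax⟩ := exists_max_image F card hF
  obtain ⟨hSX, hSne, hSX', hSel⟩ := mem_filter.1 hSF
  rw [mem_powerset] at hSX
  obtain ⟨k, w, hk, h0, hk1, hout, hinj, hwX, hwR⟩ := h.1.exists_walk hσ hSX hSne hSX'
  let v : ℕ → B := fun i => σ (w i)
  have hear : IsEar S (S.image σ) k w v := by
    refine ⟨hk, h0, mem_image_of_mem _ hk1, hout, ?_, hinj, ?_⟩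
    · intro i hi hmem
      obtain ⟨x, hx, hxw⟩ := mem_image.1 hmem
      have := hσ.1.injOn (hSX hx) (hwX _ (by omega)) hxw
      exact hout i hi (this ▸ hx)
    · intro i hi j hj hij
      exact hinj i hi j hj (hσ.1.injOn (hwX _ (by omega)) (hwX _ (by omega)) hij)
  have himg : (S ∪ inner k w).image σ = S.image σ ∪ inner k v := by
    rw [image_union, inner, inner, image_image]
    rfl
  have hWX : S ∪ inner k w ⊆ X := by
    refine union_subset hSX fun x hx => ?_
    obtain ⟨i, hi, rfl⟩ := mem_inner.1 hx
    exact hwX _ (by omega)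
  have hRsub : r S ∪ earPairs k w v ⊆ R := by
    refine union_subset inter_subset_left fun e he => ?_
    rcases mem_earPairs.1 he with ⟨i, hi, rfl⟩ | ⟨i, hi, rfl⟩
    · exact hwR i hi
    · exact hσ.2 _ (hwX _ (by omega))
  have hel := hear.elementary_union inter_subset_right (hrσ S hSX)
    (hSel.mono (subset_insert _ _) (insert_subset
      (mem_product.2 ⟨hear.left_mem, hear.right_mem⟩) inter_subset_right))
  have hXeq : S ∪ inner k w = X := by
    by_contra hne
    have := hmax (S ∪ inner k w) (mem_filter.2 ⟨mem_powerset.2 hWX,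
      hSne.mono subset_union_left, hne, by
        rw [← himg] at hel
        exact hel.mono (subset_inter hRsub hel.subset) inter_subset_right⟩)
    rw [hear.card_union_inner] at this
    omega
  have hYeq : S.image σ ∪ inner k v = Y := by
    rw [← himg, hXeq, ← coe_inj, coe_image]
    exact hσ.1.image_eq
  have hReq : r S ∪ earPairs k w v = R := by
    rw [hXeq, hYeq] at hel
    exact h.eq_of_subset hRsub hel
  refine ⟨S, S.image σ, r S, k, w, v, hear, hear.minimalElementary_of_union hSel ?_, hXeq.symm,
    hYeq.symm, hReq.symm⟩
  rw [hXeq, hYeq, hReq]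
  exact h

end BipartiteRelation

/-! ### Double stars -/

namespace BipartiteRelation

variable {A B : Type*} [DecidableEq A] [DecidableEq B]

/-- The relation obtained from two stars with centers `c` and `c'` by matching their leaves: the
leaves of `c` are the right vertices other than `c'`, those of `c'` are the left vertices other
than `c`, and the leaves are matched by `σ`. -/
structure IsDoubleStar (X : Finset A) (Y : Finset B) (R : Finset (A × B)) (c : A) (c' : B)
    (σ : A → B) : Prop where
  left_mem : c ∈ X
  right_mem : c' ∈ Y
  bijOn : Set.BijOn σ (X.erase c) (Y.erase c')
  subset : R ⊆ X ×ˢ Y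
  mem_iff : ∀ x ∈ X, ∀ y ∈ Y, (x, y) ∈ R ↔ (x = c ∧ y ≠ c') ∨ (x ≠ c ∧ (y = c' ∨ y = σ x))

variable {X : Finset A} {Y : Finset B} {R : Finset (A × B)} {c : A} {c' : B} {σ : A → B}

theorem IsDoubleStar.map_mem (h : IsDoubleStar X Y R c c' σ) {x : A} (hx : x ∈ X) (hxc : x ≠ c) :
    σ x ∈ Y ∧ σ x ≠ c' := by
  have := h.bijOn.mapsTo (mem_coe.2 (mem_erase.2 ⟨hxc, hx⟩))
  exact (mem_erase.1 (mem_coe.1 this)).symm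

theorem IsDoubleStar.card_eq (h : IsDoubleStar X Y R c c' σ) : #X = #Y := by
  have := Finset.card_nbij σ h.bijOn.mapsTo h.bijOn.injOn h.bijOn.surjOn
  rw [card_erase_of_mem h.left_mem, card_erase_of_mem h.right_mem] at this
  have := card_pos.2 ⟨_, h.left_mem⟩
  have := card_pos.2 ⟨_, h.right_mem⟩
  omega

theorem IsDoubleStar.elementary (h : IsDoubleStar X Y R c c' σ) (hX : 3 ≤ #X) :
    Elementary X Y R := by
  have hY := h.card_eq
  -- The center `c` sees all of `Y` except `c'`, and every other left vertex sees `c'`. A set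
  -- without `c` gains `c'` beyond its image under `σ`; for `{c}` alone, `3 ≤ #X` gives the surplus.
  have hmain : ∀ Z ⊆ X, Z.Nonempty → #Z < #(neighbors R Z) ∨ #Y ≤ #(neighbors R Z) := by
    intro Z hZ hne
    by_cases hc : c ∈ Z
    · by_cases hZc : Z = {c}
      · left
        have : Y.erase c' ⊆ neighbors R Z := fun y hy => by
          obtain ⟨hyc, hy⟩ := mem_erase.1 hy
          exact mem_neighbors.2 ⟨c, hc, (h.mem_iff c h.left_mem y hy).2 (Or.inl ⟨rfl, hyc⟩)⟩
        have := card_le_card this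
        rw [card_erase_of_mem h.right_mem] at this
        rw [hZc, card_singleton, ← hZc]
        omega
      · right
        obtain ⟨z, hz, hzc⟩ : ∃ z ∈ Z, z ≠ c := by
          by_contra! hcon
          exact hZc (eq_singleton_iff_unique_mem.2 ⟨hc, hcon⟩)
        refine card_le_card fun y hy => ?_
        by_cases hyc : y = c'
        · exact mem_neighbors.2 ⟨z, hz, (h.mem_iff z (hZ hz) y hy).2 (Or.inr ⟨hzc, Or.inl hyc⟩)⟩
        · exact mem_neighbors.2 ⟨c, hc, (h.mem_iff c h.left_mem y hy).2 (Or.inl ⟨rfl, hyc⟩)⟩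
    · left
      have hzc : ∀ z ∈ Z, z ≠ c := fun z hz hzc => hc (hzc ▸ hz)
      have hsub : insert c' (Z.image σ) ⊆ neighbors R Z := by
        intro y hy
        rcases mem_insert.1 hy with rfl | hy
        · obtain ⟨z, hz⟩ := hne
          exact mem_neighbors.2 ⟨z, hz, (h.mem_iff z (hZ hz) _ h.right_mem).2
            (Or.inr ⟨hzc z hz, Or.inl rfl⟩)⟩
        · obtain ⟨z, hz, rfl⟩ := mem_image.1 hy
          exact mem_neighbors.2 ⟨z, hz, (h.mem_iff z (hZ hz) _ (h.map_mem (hZ hz) (hzc z hz)).1).2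
            (Or.inr ⟨hzc z hz, Or.inr rfl⟩)⟩
      have hcard := card_le_card hsub
      rw [card_insert_of_notMem, card_image_of_injOn] at hcard
      · omega
      · refine h.bijOn.injOn.mono fun z hz => ?_
        exact mem_coe.2 (mem_erase.2 ⟨hzc z hz, hZ hz⟩)
      · intro hmem
        obtain ⟨z, hz, hzc'⟩ := mem_image.1 hmem
        exact (h.map_mem (hZ hz) (hzc z hz)).2 hzc'
  refine ⟨h.subset, hY, fun Z hZ => ?_, fun Z hZ hne hZX => ?_⟩
  · rcases Z.eq_empty_or_nonempty with rfl | hne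
    · simp
    · rcases hmain Z hZ hne with h1 | h1
      · exact h1.le
      · exact (card_le_card hZ).trans (hY ▸ h1)
  · rcases hmain Z hZ hne with h1 | h1
    · exact h1
    · exact (card_lt_card (hZ.ssubset_of_ne hZX)).trans_le (hY ▸ h1)

/-- Each pair has an end of degree two: the right end if the left end is `c`, and otherwise the left
end. Removing the pair leaves that end with degree one, which an elementary relation does not allow.
-/
theorem IsDoubleStar.minimalElementary (h : IsDoubleStar X Y R c c' σ) (hX : 3 ≤ #X) :
    MinimalElementary X Y R := by
  refine ⟨h.elementary hX, ?_⟩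
  rintro ⟨x, y⟩ hxy hel
  obtain ⟨hx, hy⟩ := mem_product.1 (h.subset hxy)
  dsimp only at hx hy
  by_cases hxc : x = c
  · subst hxc
    have hyc : y ≠ c' := by
      rcases (h.mem_iff x hx y hy).1 hxy with h1 | h1
      exacts [h1.2, (h1.1 rfl).elim]
    obtain ⟨z, hz, rfl⟩ := h.bijOn.surjOn (mem_coe.2 (mem_erase.2 ⟨hyc, hy⟩))
    obtain ⟨hzx, hzX⟩ := mem_erase.1 (mem_coe.1 hz)
    obtain ⟨u, huz, hu⟩ := hel.exists_left_ne (by omega) hy hzX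
    obtain ⟨hne, hu⟩ := mem_erase.1 hu
    have hux : u ≠ x := fun hux => hne (by rw [hux])
    have huX := (mem_product.1 (h.subset hu)).1
    rcases (h.mem_iff u huX _ hy).1 hu with h1 | ⟨_, h1 | h1⟩
    · exact hux h1.1
    · exact hyc h1
    · exact huz (h.bijOn.injOn (mem_coe.2 (mem_erase.2 ⟨hux, huX⟩)) hz h1.symm)
  · obtain ⟨u, hu⟩ : ∃ u, ∀ y', (x, y') ∈ R → y' = y ∨ y' = u := by
      have hrow : ∀ y', (x, y') ∈ R → y' = c' ∨ y' = σ x := fun y' hy' => by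
        rcases (h.mem_iff x hx y' (mem_product.1 (h.subset hy')).2).1 hy' with h1 | h1
        exacts [(hxc h1.1).elim, h1.2]
      rcases hrow y hxy with rfl | rfl
      · exact ⟨σ x, hrow⟩
      · exact ⟨c', fun y' hy' => (hrow y' hy').symm⟩
    obtain ⟨y', hy', hmem⟩ := hel.exists_right_ne (by omega) hx u
    obtain ⟨hne, hmem⟩ := mem_erase.1 hmem
    rcases hu y' hmem with rfl | rfl
    exacts [hne rfl, hy' rfl]

theorem IsDoubleStar.card (h : IsDoubleStar X Y R c c' σ) : #R + 3 = 3 * #X := by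
  -- The two stars and the leaf matching each have `#X - 1` pairs.
  have hR : R = {c} ×ˢ Y.erase c' ∪ ((X.erase c) ×ˢ {c'} ∪ (X.erase c).image fun x => (x, σ x)) := by
    ext ⟨x, y⟩
    simp only [mem_union, mem_product, mem_singleton, mem_erase, mem_image, Prod.mk.injEq]
    constructor
    · intro hxy
      obtain ⟨hx, hy⟩ := mem_product.1 (h.subset hxy)
      have := (h.mem_iff x hx y hy).1 hxy
      dsimp only at hx hy
      grind
    · rintro (⟨rfl, hyc, hy⟩ | ⟨⟨hxc, hx⟩, rfl⟩ | ⟨z, ⟨hxc, hx⟩, rfl, rfl⟩)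
      · exact (h.mem_iff _ h.left_mem y hy).2 (Or.inl ⟨rfl, hyc⟩)
      · exact (h.mem_iff x hx _ h.right_mem).2 (Or.inr ⟨hxc, Or.inl rfl⟩)
      · exact (h.mem_iff z hx _ (h.map_mem hx hxc).1).2 (Or.inr ⟨hxc, Or.inr rfl⟩)
  have hm := h.card_eq
  have hpos := card_pos.2 ⟨_, h.left_mem⟩
  rw [hR, card_union_of_disjoint, card_union_of_disjoint, card_product, card_product,
    card_image_of_injOn, card_erase_of_mem h.left_mem, card_erase_of_mem h.right_mem,
    card_singleton, card_singleton]
  · omega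
  · exact fun x _ y _ hxy => congrArg Prod.fst hxy
  · rw [disjoint_right]
    intro e he he'
    obtain ⟨x, hx, rfl⟩ := mem_image.1 he
    obtain ⟨hxc, hx⟩ := mem_erase.1 hx
    exact (h.map_mem hx hxc).2 (mem_singleton.1 (mem_product.1 he').2)
  · rw [disjoint_left]
    rintro ⟨x, y⟩ he he'
    simp only [mem_union, mem_product, mem_singleton, mem_erase, mem_image, Prod.mk.injEq] at he he'
    grind

theorem IsDoubleStar.erase_leaf (h : IsDoubleStar X Y R c c' σ) {z : A} (hz : z ∈ X)
    (hzc : z ≠ c) : IsDoubleStar (X.erase z) (Y.erase (σ z))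
      (R ∩ (X.erase z) ×ˢ (Y.erase (σ z))) c c' σ := by
  have hσz := h.map_mem hz hzc
  refine ⟨mem_erase.2 ⟨hzc.symm, h.left_mem⟩, mem_erase.2 ⟨hσz.2.symm, h.right_mem⟩, ?_,
    inter_subset_right, ?_⟩
  · rw [erase_right_comm, erase_right_comm (s := Y), coe_erase (s := X.erase c),
      coe_erase (s := Y.erase c')]
    exact h.bijOn.sdiff_singleton (mem_coe.2 (mem_erase.2 ⟨hzc, hz⟩))
  · intro x hx y hy
    rw [mem_inter, h.mem_iff x (mem_erase.1 hx).2 y (mem_erase.1 hy).2]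
    exact and_iff_left (mem_product.2 ⟨hx, hy⟩)

/-- An elementary relation with three left vertices and six pairs is a hexagon. -/
theorem Elementary.exists_isDoubleStar (h : Elementary X Y R) (hX : #X = 3) (hR : #R = 6) {a : A}
    {b : B} (ha : a ∈ X) (hb : b ∈ Y) (hab : (a, b) ∉ R) :
    ∃ σ, IsDoubleStar X Y R a b σ := by
  -- All degrees are at least two and sum to six over three vertices, so they are exactly two. Hence
  -- any nonadjacent `a` and `b` can serve as centers.
  have hrow : ∀ x ∈ X, #(R.filter fun e => e.1 = x) = 2 := by
    have hge : ∀ x ∈ X, 2 ≤ #(R.filter fun e => e.1 = x) := by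
      intro x hx
      obtain ⟨y, _, hy⟩ := h.exists_right_ne (by omega) hx b
      obtain ⟨y', hyy, hy'⟩ := h.exists_right_ne (by omega) hx y
      exact one_lt_card.2 ⟨(x, y), by simp [hy], (x, y'), by simp [hy'], by simpa using hyy.symm⟩
    have hsum := card_eq_sum_card_fiberwise (f := Prod.fst) (s := R) (t := X)
      (fun e he => (mem_product.1 (h.subset he)).1)
    have heq : ∑ x ∈ X, 2 = ∑ x ∈ X, #(R.filter fun e => e.1 = x) := by
      rw [← hsum, hR, sum_const, hX]; rfl
    exact fun x hx => ((sum_eq_sum_iff_of_le hge).1 heq x hx).symm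
  have hcol : ∀ y ∈ Y, #(R.filter fun e => e.2 = y) = 2 := by
    have hge : ∀ y ∈ Y, 2 ≤ #(R.filter fun e => e.2 = y) := by
      intro y hy
      obtain ⟨x, _, hx⟩ := h.exists_left_ne (by omega) hy ha
      obtain ⟨x', hxx, hx'⟩ := h.exists_left_ne (by omega) hy (mem_product.1 (h.subset hx)).1
      exact one_lt_card.2 ⟨(x, y), by simp [hx], (x', y), by simp [hx'], by simpa using hxx.symm⟩
    have hsum := card_eq_sum_card_fiberwise (f := Prod.snd) (s := R) (t := Y)
      (fun e he => (mem_product.1 (h.subset he)).2)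
    have heq : ∑ y ∈ Y, 2 = ∑ y ∈ Y, #(R.filter fun e => e.2 = y) := by
      rw [← hsum, hR, sum_const, ← h.card_eq, hX]; rfl
    exact fun y hy => ((sum_eq_sum_iff_of_le hge).1 heq y hy).symm
  have harow : ∀ y ∈ Y, y ≠ b → (a, y) ∈ R := by
    have hsub : (R.filter fun e => e.1 = a).image Prod.snd ⊆ Y.erase b := by
      intro y hy
      obtain ⟨⟨x, y⟩, hmem, rfl⟩ := mem_image.1 hy
      obtain ⟨hxy, rfl⟩ := mem_filter.1 hmem
      exact mem_erase.2 ⟨fun hyb => hab (hyb ▸ hxy), (mem_product.1 (h.subset hxy)).2⟩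
    have heq := eq_of_subset_of_card_le hsub (by
      rw [card_erase_of_mem hb, ← h.card_eq, hX, card_image_of_injOn, hrow a ha]
      intro e he f hf hef
      exact Prod.ext ((mem_filter.1 he).2.trans (mem_filter.1 hf).2.symm) hef)
    intro y hy hyb
    obtain ⟨⟨x, y⟩, hmem, rfl⟩ := mem_image.1 (heq ▸ mem_erase.2 ⟨hyb, hy⟩)
    obtain ⟨hxy, rfl⟩ := mem_filter.1 hmem
    exact hxy
  have hbcol : ∀ x ∈ X, x ≠ a → (x, b) ∈ R := by
    have hsub : (R.filter fun e => e.2 = b).image Prod.fst ⊆ X.erase a := by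
      intro x hx
      simp only [mem_image, mem_filter, Prod.exists] at hx
      obtain ⟨x, y, ⟨hxy, rfl⟩, rfl⟩ := hx
      exact mem_erase.2 ⟨fun hxa => hab (hxa ▸ hxy), (mem_product.1 (h.subset hxy)).1⟩
    have heq := eq_of_subset_of_card_le hsub (by
      rw [card_erase_of_mem ha, hX, card_image_of_injOn, hcol b hb]
      intro e he f hf hef
      exact Prod.ext hef ((mem_filter.1 he).2.trans (mem_filter.1 hf).2.symm))
    intro x hx hxa
    have := heq ▸ mem_erase.2 ⟨hxa, hx⟩
    simp only [mem_image, mem_filter, Prod.exists] at this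
    obtain ⟨x, y, ⟨hxy, rfl⟩, rfl⟩ := this
    exact hxy
  have hrow' : ∀ x ∈ X, x ≠ a → ∃ y, y ≠ b ∧ (x, y) ∈ R := fun x hx _ =>
    h.exists_right_ne (by omega) hx b
  have : Nonempty B := ⟨b⟩
  choose! σ hσb hσ using hrow'
  have hσu : ∀ x ∈ X, x ≠ a → ∀ y, (x, y) ∈ R → y ≠ b → y = σ x := by
    intro x hx hxa y hxy hyb
    by_contra hne
    have : 2 < #(R.filter fun e => e.1 = x) := two_lt_card.2
      ⟨(x, b), by simp [hbcol x hx hxa], (x, y), by simp [hxy], (x, σ x), by simp [hσ x hx hxa],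
        by simpa using hyb.symm, by simpa using (hσb x hx hxa).symm, by simpa using hne⟩
    rw [hrow x hx] at this
    omega
  refine ⟨σ, ha, hb, ⟨?_, ?_, ?_⟩, h.subset, ?_⟩
  · intro x hx
    obtain ⟨hxa, hx⟩ := mem_erase.1 (mem_coe.1 hx)
    exact mem_coe.2 (mem_erase.2 ⟨hσb x hx hxa, (mem_product.1 (h.subset (hσ x hx hxa))).2⟩)
  · intro x hx z hz hxz
    obtain ⟨hxa, hx⟩ := mem_erase.1 (mem_coe.1 hx)
    obtain ⟨hza, hz⟩ := mem_erase.1 (mem_coe.1 hz)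
    by_contra hne
    have hy := (mem_product.1 (h.subset (hσ x hx hxa))).2
    have h3 := hσ z hz hza
    rw [← hxz] at h3
    have : 2 < #(R.filter fun e => e.2 = σ x) := two_lt_card.2
      ⟨(a, σ x), by simp [harow _ hy (hσb x hx hxa)], (x, σ x), by simp [hσ x hx hxa],
        (z, σ x), by simp [h3], by simpa using Ne.symm hxa, by simpa using Ne.symm hza,
        by simpa using hne⟩
    rw [hcol _ hy] at this
    omega
  · intro y hy
    obtain ⟨hyb, hy⟩ := mem_erase.1 (mem_coe.1 hy)
    obtain ⟨x, hxa, hxy⟩ := h.exists_left_ne (by omega) hy ha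
    have hx := (mem_product.1 (h.subset hxy)).1
    exact ⟨x, mem_coe.2 (mem_erase.2 ⟨hxa, hx⟩), (hσu x hx hxa y hxy hyb).symm⟩
  · intro x hx y hy
    constructor
    · intro hxy
      by_cases hxa : x = a
      · exact Or.inl ⟨hxa, fun hyb => hab (hxa ▸ hyb ▸ hxy)⟩
      · by_cases hyb : y = b
        · exact Or.inr ⟨hxa, Or.inl hyb⟩
        · exact Or.inr ⟨hxa, Or.inr (hσu x hx hxa y hxy hyb)⟩
    · rintro (⟨rfl, hyb⟩ | ⟨hxa, rfl | rfl⟩)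
      · exact harow y hy hyb
      · exact hbcol x hx hxa
      · exact hσ x hx hxa

end BipartiteRelation

/-! ### Ears of length three on double stars, and the extremal relations -/

namespace BipartiteRelation

variable {A B : Type*} [DecidableEq A] [DecidableEq B]
variable {S : Finset A} {T : Finset B} {w : ℕ → A} {v : ℕ → B} {R₀ : Finset (A × B)} {c : A}
  {c' : B} {σ : A → B}

theorem mem_union_earPairs_one {e : A × B} : e ∈ R₀ ∪ earPairs 1 w v ↔
    e ∈ R₀ ∨ e = (w 0, v 1) ∨ e = (w 1, v 2) ∨ e = (w 1, v 1) := by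
  simp only [earPairs, mem_union, mem_image, mem_range]
  constructor
  · rintro (h | ⟨i, hi, rfl⟩ | ⟨i, hi, rfl⟩)
    · exact Or.inl h
    · interval_cases i <;> simp
    · interval_cases i; simp
  · rintro (h | rfl | rfl | rfl)
    · exact Or.inl h
    · exact Or.inr (Or.inl ⟨0, by omega, rfl⟩)
    · exact Or.inr (Or.inl ⟨1, by omega, rfl⟩)
    · exact Or.inr (Or.inr ⟨0, by omega, rfl⟩)

theorem inner_one {C : Type*} [DecidableEq C] (f : ℕ → C) : inner 1 f = {f 1} := by
  simp [inner]

/-- Joining the centers of a double star by an ear of length three gives a double star. -/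
theorem IsDoubleStar.union_earPairs (h : IsDoubleStar S T R₀ c c' σ) (hear : IsEar S T 1 w v)
    (hw : w 0 = c) (hv : v 2 = c') :
    ∃ τ, IsDoubleStar (S ∪ inner 1 w) (T ∪ inner 1 v) (R₀ ∪ earPairs 1 w v) c c' τ := by
  have hwS := hear.left_notMem 0 one_pos
  have hvT := hear.right_notMem 0 one_pos
  rw [zero_add] at hwS hvT
  have hwc : w 1 ≠ c := fun heq => hwS (heq ▸ h.left_mem)
  have hvc : v 1 ≠ c' := fun heq => hvT (heq ▸ h.right_mem)
  have hsub : R₀ ∪ earPairs 1 w v ⊆ (S ∪ inner 1 w) ×ˢ (T ∪ inner 1 v) :=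
    union_subset (h.subset.trans (product_subset_product subset_union_left subset_union_left))
      hear.earPairs_subset
  have hτ : ∀ x ∈ S, Function.update σ (w 1) (v 1) x = σ x := fun x hx =>
    Function.update_of_ne (fun heq : x = w 1 => hwS (heq ▸ hx)) _ _
  refine ⟨Function.update σ (w 1) (v 1), mem_union_left _ h.left_mem,
    mem_union_left _ h.right_mem, ?_, hsub, ?_⟩
  · have h1 : (S ∪ inner 1 w).erase c = insert (w 1) (S.erase c) := by
      rw [inner_one, union_comm, ← insert_eq, erase_insert_of_ne hwc]
    have h2 : (T ∪ inner 1 v).erase c' = insert (v 1) (T.erase c') := by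
      rw [inner_one, union_comm, ← insert_eq, erase_insert_of_ne hvc]
    rw [h1, h2, coe_insert, coe_insert]
    have h3 : Set.BijOn (Function.update σ (w 1) (v 1)) (S.erase c) (T.erase c') :=
      h.bijOn.congr fun x hx => (hτ x (mem_erase.1 (mem_coe.1 hx)).2).symm
    have h4 := h3.insert (a := w 1) (by
      rw [Function.update_self]
      exact fun hmem => hvT (mem_erase.1 (mem_coe.1 hmem)).2)
    rwa [Function.update_self] at h4
  · intro x hx y hy
    rw [mem_union_earPairs_one, hw, hv]
    rw [mem_union, inner_one, mem_singleton] at hx hy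
    have hmem : (x, y) ∈ R₀ → x ∈ S ∧ y ∈ T := fun hmem => mem_product.1 (h.subset hmem)
    simp only [Prod.mk.injEq]
    rcases hx with hx | rfl <;> rcases hy with hy | rfl
    · rw [h.mem_iff x hx y hy, hτ x hx]
      have : x ≠ w 1 := fun heq => hwS (heq ▸ hx)
      have : y ≠ v 1 := fun heq => hvT (heq ▸ hy)
      tauto
    · rw [hτ x hx]
      have h1 : x ≠ w 1 := fun heq => hwS (heq ▸ hx)
      have h2 : x ≠ c → v 1 ≠ σ x := fun hxc heq => hvT (heq ▸ (h.map_mem hx hxc).1)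
      tauto
    · rw [Function.update_self]
      tauto
    · rw [Function.update_self]
      tauto

/-- Joining two nonadjacent vertices of a double star by an ear of length three does not give a
minimal elementary relation, unless the double star is a hexagon or the vertices are its
centers. -/
theorem IsDoubleStar.not_minimalElementary_union (h : IsDoubleStar S T R₀ c c' σ)
    (hS : 4 ≤ #S) (hear : IsEar S T 1 w v) (hnot : (w 0, v 2) ∉ R₀) (hw : w 0 ≠ c) :
    ¬ MinimalElementary (S ∪ inner 1 w) (T ∪ inner 1 v) (R₀ ∪ earPairs 1 w v) := by
  intro hmin
  have haS := hear.left_mem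
  have hbT : v 2 ∈ T := hear.right_mem
  have hwS := hear.left_notMem 0 one_pos
  have hvT := hear.right_notMem 0 one_pos
  rw [zero_add] at hwS hvT
  rw [h.mem_iff _ haS _ hbT] at hnot
  have hbc : v 2 ≠ c' := fun heq => hnot (Or.inr ⟨hw, Or.inl heq⟩)
  have hbσ : v 2 ≠ σ (w 0) := fun heq => hnot (Or.inr ⟨hw, Or.inr heq⟩)
  -- The leaf pair `z`, `v 2` is removed from the double star and restored as part of the longer ear
  -- `w 0, v 1, w 1, v 2, z, c'`. This uses no pair `(c, v 2)`, which is therefore redundant.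
  obtain ⟨z, hz, hzb⟩ := h.bijOn.surjOn (mem_coe.2 (mem_erase.2 ⟨hbc, hbT⟩))
  obtain ⟨hzc, hzS⟩ := mem_erase.1 (mem_coe.1 hz)
  have hza : w 0 ≠ z := fun heq => hbσ (by rw [heq, hzb])
  have hwz : w 1 ≠ z := fun heq => hwS (heq ▸ hzS)
  have hstar := h.erase_leaf hzS hzc
  -- Here `4 ≤ #S` is needed: the smaller double star must keep three left vertices to be
  -- elementary.
  have hstar_el := hstar.elementary (by rw [card_erase_of_mem hzS]; omega)
  rw [hzb] at hstar hstar_el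
  set S' := S.erase z
  set T' := T.erase (v 2)
  set R' := R₀ ∩ S' ×ˢ T'
  let w' : ℕ → A := fun i => if i = 2 then z else w i
  let v' : ℕ → B := fun i => if i = 3 then c' else v i
  have hear' : IsEar S' T' 2 w' v' := by
    refine ⟨two_pos, mem_erase.2 ⟨hza, haS⟩, mem_erase.2 ⟨hbc.symm, h.right_mem⟩, ?_, ?_, ?_, ?_⟩
    · intro i hi
      interval_cases i
      · exact fun hmem => hwS (mem_erase.1 hmem).2
      · exact notMem_erase _ _
    · intro i hi
      interval_cases i
      · exact fun hmem => hvT (mem_erase.1 hmem).2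
      · exact notMem_erase _ _
    · intro i hi j hj hij
      interval_cases i <;> interval_cases j
      exacts [rfl, (hwz hij).elim, (hwz hij.symm).elim, rfl]
    · have hvv : v 1 ≠ v 2 := fun heq => hvT (heq ▸ hbT)
      intro i hi j hj hij
      interval_cases i <;> interval_cases j
      exacts [rfl, (hvv hij).elim, (hvv hij.symm).elim, rfl]
  obtain ⟨ρ, hρ⟩ := hstar_el.exists_matchingMap ⟨_, hstar.left_mem⟩
  have hel := hear'.elementary_union hstar.subset hρ (hstar_el.mono (subset_insert _ _)
    (insert_subset (mem_product.2 ⟨hear'.left_mem, hear'.right_mem⟩) hstar.subset))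
  have hX : S' ∪ inner 2 w' = S ∪ inner 1 w := by
    have : inner 2 w' = {w 1, z} := by
      ext x
      simp [mem_inner, w', Nat.le_one_iff_eq_zero_or_eq_one]
    rw [this, inner_one, ← insert_erase hzS]
    ext x
    simp only [S', mem_union, mem_insert, mem_singleton]
    tauto
  have hY : T' ∪ inner 2 v' = T ∪ inner 1 v := by
    have : inner 2 v' = {v 1, v 2} := by
      ext x
      simp [mem_inner, v', Nat.le_one_iff_eq_zero_or_eq_one]
    rw [this, inner_one, ← insert_erase hbT]
    ext x
    simp only [T', mem_union, mem_insert, mem_singleton]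
    tauto
  rw [hX, hY] at hel
  have hcb : (c, v 2) ∈ R₀ := (h.mem_iff c h.left_mem _ hbT).2 (Or.inl ⟨rfl, hbc⟩)
  have hcw : c ≠ w 1 := fun heq => hwS (heq ▸ h.left_mem)
  refine hmin.2 (c, v 2) (mem_union_left _ hcb) (hel.mono ?_
    ((erase_subset _ _).trans hmin.1.subset))
  intro e he
  rw [mem_erase, mem_union_earPairs_one]
  rcases mem_union.1 he with he | he
  · obtain ⟨h1, h2⟩ := mem_inter.1 he
    refine ⟨?_, Or.inl h1⟩
    rintro rfl
    exact notMem_erase _ _ (mem_product.1 h2).2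
  · rcases mem_earPairs.1 he with ⟨i, hi, rfl⟩ | ⟨i, hi, rfl⟩
    · interval_cases i
      · refine ⟨fun heq => hw (congrArg Prod.fst heq), Or.inr (Or.inl rfl)⟩
      · exact ⟨fun heq => hcw (congrArg Prod.fst heq).symm, Or.inr (Or.inr (Or.inl rfl))⟩
      · exact ⟨fun heq => hbc (congrArg Prod.snd heq).symm,
          Or.inl ((h.mem_iff z hzS _ h.right_mem).2 (Or.inr ⟨hzc, Or.inl rfl⟩))⟩
    · interval_cases i
      · exact ⟨fun heq => hcw (congrArg Prod.fst heq).symm, Or.inr (Or.inr (Or.inr rfl))⟩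
      · exact ⟨fun heq => hzc (congrArg Prod.fst heq),
          Or.inl ((h.mem_iff z hzS _ hbT).2 (Or.inr ⟨hzc, Or.inr hzb.symm⟩))⟩

theorem Elementary.eq_product_of_card_eq_two {X : Finset A} {Y : Finset B} {R : Finset (A × B)}
    (h : Elementary X Y R) (hX : #X = 2) : R = X ×ˢ Y := by
  refine h.subset.antisymm ?_
  rintro ⟨x, y⟩ hxy
  obtain ⟨hx, hy⟩ := mem_product.1 hxy
  by_contra hnot
  have hsub : neighbors R {x} ⊆ Y.erase y := by
    intro z hz
    obtain ⟨x', hx', hxz⟩ := mem_neighbors.1 hz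
    obtain rfl := mem_singleton.1 hx'
    exact mem_erase.2 ⟨fun heq => hnot (heq ▸ hxz), (mem_product.1 (h.subset hxz)).2⟩
  have h1 := h.hall_strict {x} (by simpa using hx) (by simp) (by rintro rfl; simp at hX)
  have h2 := card_le_card hsub
  rw [card_erase_of_mem hy, ← h.card_eq, hX] at h2
  rw [card_singleton] at h1
  omega

/-- A minimal elementary relation with `m ≥ 3` left vertices has at most `3 m - 3` pairs, and the
relations that attain this bound are double stars. -/
theorem MinimalElementary.card_le_and_isDoubleStar {X : Finset A} {Y : Finset B}
    {R : Finset (A × B)} (h : MinimalElementary X Y R) (hX : 3 ≤ #X) :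
    #R + 3 ≤ 3 * #X ∧ (#R + 3 = 3 * #X → ∃ c c' σ, IsDoubleStar X Y R c c' σ) := by
  induction hm : #X using Nat.strong_induction_on generalizing X Y R with
  | _ m ih =>
  obtain ⟨S, T, R₀, k, w, v, hear, hmin, hXeq, hYeq, hReq⟩ := h.exists_ear (by omega)
  have hcardX : #X = #S + k := by rw [hXeq, hear.card_union_inner]
  have hcardR : #R = #R₀ + (2 * k + 1) := by rw [hReq, hear.card_union_earPairs hmin.1.subset]
  have hpos := hear.pos
  have hSpos := card_pos.2 ⟨_, hear.left_mem⟩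
  have hnot : 2 ≤ #S → (w 0, v (k + 1)) ∉ R₀ := fun hS =>
    hear.notMem_of_minimalElementary hmin.1 hS (by rwa [← hXeq, ← hYeq, ← hReq])
  rcases (show #S = 1 ∨ #S = 2 ∨ 3 ≤ #S by omega) with hS | hS | hS
  -- With a single initial pair, `#R = 2 * k + 2` and `#X = k + 1`, so the bound amounts to `k ≥ 2`,
  -- with equality for the hexagon.
  · have hR₀ : #R₀ ≤ 1 := by
      have := card_le_card hmin.1.subset
      rwa [card_product, ← hmin.1.card_eq, hS] at this
    have hR₀' : 1 ≤ #R₀ := by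
      obtain ⟨ρ, hρ⟩ := hmin.1.exists_matchingMap ⟨_, hear.left_mem⟩
      exact card_pos.2 ⟨_, hρ.2 _ hear.left_mem⟩
    refine ⟨by omega, fun heq => ?_⟩
    have hR6 : #R = 6 := by omega
    have hX3 : #X = 3 := by omega
    obtain ⟨⟨a, b⟩, hab, hab'⟩ : ∃ e ∈ X ×ˢ Y, e ∉ R := by
      refine exists_mem_notMem_of_card_lt_card ?_
      rw [card_product, ← h.1.card_eq, hX3, hR6]
      norm_num
    obtain ⟨ha, hb⟩ := mem_product.1 hab
    exact ⟨a, b, h.1.exists_isDoubleStar hX3 hR6 ha hb hab'⟩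
  · refine (hnot hS.ge ?_).elim
    rw [hmin.1.eq_product_of_card_eq_two hS]
    exact mem_product.2 ⟨hear.left_mem, hear.right_mem⟩
  · obtain ⟨hle, hstar⟩ := ih #S (by omega) hmin hS rfl
    refine ⟨by omega, fun heq => ?_⟩
    -- Equality forces `2 * k + 1 = 3 * k` and equality for `R₀`.
    obtain rfl : k = 1 := by omega
    obtain ⟨c, c', σ, hds⟩ := hstar (by omega)
    have hnot := hnot (by omega)
    subst hXeq hYeq hReq
    have hcenter : ∀ c c' σ, IsDoubleStar S T R₀ c c' σ → w 0 = c → v 2 = c' →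
        ∃ c c' σ, IsDoubleStar (S ∪ inner 1 w) (T ∪ inner 1 v) (R₀ ∪ earPairs 1 w v) c c' σ :=
      fun c c' σ hds hw hv => ⟨c, c', hds.union_earPairs hear hw hv⟩
    by_cases hw : w 0 = c
    · by_cases hv : v 2 = c'
      · exact hcenter c c' σ hds hw hv
      · exact (hnot ((hds.mem_iff _ hear.left_mem _ hear.right_mem).2 (Or.inl ⟨hw, hv⟩))).elim
    -- A hexagon has no preferred centers, so they are chosen anew at the ends of the ear.
    · rcases hS.eq_or_lt with hS | hS
      · obtain ⟨τ, hτ⟩ := hmin.1.exists_isDoubleStar hS.symm (by omega) hear.left_mem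
          hear.right_mem hnot
        exact hcenter _ _ τ hτ rfl rfl
      · exact (hds.not_minimalElementary_union hS hear hnot hw h).elim

end BipartiteRelation

/-! ### From multigraphs to relations -/

namespace Graph

open BipartiteRelation

variable {α β : Type*} {G : Graph α β} {X Y : Finset α}

/-- The finite sets `X` and `Y` are the color classes of the bipartite graph `G`. -/
structure IsBipartition (G : Graph α β) (X Y : Finset α) : Prop where
  disjoint : Disjoint X Y
  union_eq : (X : Set α) ∪ Y = V(G)
  mem_or_mem : ∀ ⦃e x y⦄, G.IsLink e x y → (x ∈ X ∧ y ∈ Y) ∨ (x ∈ Y ∧ y ∈ X)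

open Classical in
/-- The pairs of adjacent vertices of `X` and `Y`. -/
noncomputable def biadjacency (G : Graph α β) (X Y : Finset α) : Finset (α × α) :=
  (X ×ˢ Y).filter fun e => G.Adj e.1 e.2

theorem mem_biadjacency {x y : α} :
    (x, y) ∈ G.biadjacency X Y ↔ x ∈ X ∧ y ∈ Y ∧ G.Adj x y := by
  simp [biadjacency, and_assoc]

theorem biadjacency_subset : G.biadjacency X Y ⊆ X ×ˢ Y := by
  classical exact filter_subset _ _

namespace IsBipartition

theorem notMem_right (h : G.IsBipartition X Y) {x : α} (hx : x ∈ X) : x ∉ Y :=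
  disjoint_left.1 h.disjoint hx

theorem loopless (h : G.IsBipartition X Y) : G.Loopless := by
  refine ⟨fun e x hex => ?_⟩
  rcases h.mem_or_mem hex with h1 | h1
  · exact h.notMem_right h1.1 h1.2
  · exact h.notMem_right h1.2 h1.1

theorem mem_or (h : G.IsBipartition X Y) {x : α} (hx : x ∈ V(G)) : x ∈ X ∨ x ∈ Y := by
  rw [← h.union_eq] at hx
  exact hx

theorem left_mem (h : G.IsBipartition X Y) {x : α} (hx : x ∈ X) : x ∈ V(G) :=
  h.union_eq ▸ Or.inl hx

theorem right_mem (h : G.IsBipartition X Y) {x : α} (hx : x ∈ Y) : x ∈ V(G) :=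
  h.union_eq ▸ Or.inr hx

theorem mem_right_of_isLink (h : G.IsBipartition X Y) {e : β} {x y : α} (hx : x ∈ X)
    (he : G.IsLink e x y) : y ∈ Y :=
  (h.mem_or_mem he).elim And.right fun h1 => (h.notMem_right hx h1.1).elim

theorem mem_left_of_isLink (h : G.IsBipartition X Y) {e : β} {x y : α} (hx : x ∈ Y)
    (he : G.IsLink e x y) : y ∈ X :=
  (h.mem_or_mem he).elim (fun h1 => (h.notMem_right h1.1 hx).elim) And.right

theorem mem_biadjacency_of_isLink (h : G.IsBipartition X Y) {e : β} {x y : α} (hx : x ∈ X)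
    (he : G.IsLink e x y) : (x, y) ∈ G.biadjacency X Y :=
  mem_biadjacency.2 ⟨hx, h.mem_right_of_isLink hx he, he.adj⟩

theorem exists_isLink (h : G.IsBipartition X Y) {e : β} (he : e ∈ E(G)) :
    ∃ x ∈ X, ∃ y ∈ Y, G.IsLink e x y := by
  obtain ⟨x, y, hxy⟩ := exists_isLink_of_mem_edgeSet he
  rcases h.mem_or_mem hxy with h1 | h1
  · exact ⟨x, h1.1, y, h1.2, hxy⟩
  · exact ⟨y, h1.2, x, h1.1, hxy.symm⟩

theorem deleteEdges (h : G.IsBipartition X Y) (F : Set β) :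
    (G.deleteEdges F).IsBipartition X Y :=
  ⟨h.disjoint, h.union_eq, fun _ _ _ he => h.mem_or_mem he.1⟩

theorem ncard_vertexSet (h : G.IsBipartition X Y) : V(G).ncard = #X + #Y := by
  classical
  rw [← h.union_eq, ← coe_union, Set.ncard_coe_finset, card_union_of_disjoint h.disjoint]

variable [DecidableEq α]

theorem exists_matchingMap (h : G.IsBipartition X Y) {M : Set β} (hM : G.IsPerfectMatching M) :
    ∃ σ, IsMatchingMap X Y (G.biadjacency X Y) σ ∧
      ∀ e ∈ M, ∀ x ∈ X, ∀ y, G.IsLink e x y → σ x = y := by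
  have hex : ∀ x, ∃ y, x ∈ X → ∃ e ∈ M, G.IsLink e x y := by
    intro x
    by_cases hx : x ∈ X
    · obtain ⟨e, he, y, hy⟩ := hM.2 x (h.left_mem hx)
      exact ⟨y, fun _ => ⟨e, he, hy⟩⟩
    · exact ⟨x, fun hx' => (hx hx').elim⟩
  choose σ hσ using hex
  have huniq : ∀ e ∈ M, ∀ x ∈ X, ∀ y, G.IsLink e x y → σ x = y := by
    intro e he x hx y hxy
    obtain ⟨f, hf, hfx⟩ := hσ x hx
    obtain rfl := hM.1.2.2 e he f hf x hxy.inc_left hfx.inc_left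
    exact hfx.right_unique hxy
  refine ⟨σ, ⟨⟨?_, ?_, ?_⟩, ?_⟩, huniq⟩
  · intro x hx
    obtain ⟨e, he, hxy⟩ := hσ x hx
    exact h.mem_right_of_isLink hx hxy
  · intro x hx z hz hxz
    obtain ⟨e, he, hex⟩ := hσ x hx
    obtain ⟨f, hf, hfz⟩ := hσ z hz
    rw [← hxz] at hfz
    obtain rfl := hM.1.2.2 e he f hf _ hex.inc_right hfz.inc_right
    exact hex.left_unique hfz
  · intro y hy
    obtain ⟨e, he, x, hyx⟩ := hM.2 y (h.right_mem hy)
    have hx := h.mem_left_of_isLink hy hyx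
    exact ⟨x, hx, huniq e he x hx y hyx.symm⟩
  · intro x hx
    obtain ⟨e, he, hxy⟩ := hσ x hx
    exact h.mem_biadjacency_of_isLink hx hxy

/-- Let `Z` be closed. A perfect matching through an edge from `x` to `σ(Z)` maps `Z` onto `σ(Z)`,
which forces `x ∈ Z`. So no edge leaves `Z ∪ σ(Z)`, and connectedness makes this the whole vertex
set. -/
theorem elementary_of_isMatchingCovered (h : G.IsBipartition X Y) (hG : G.IsMatchingCovered) :
    Elementary X Y (G.biadjacency X Y) := by
  have := h.loopless
  obtain ⟨hconn, hcard, hpm⟩ := hG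
  have hedge : ∃ e, e ∈ E(G) := by
    have : Nontrivial V(G) := Set.nontrivial_coe_sort.2
      (Set.one_lt_ncard_iff_nontrivial_and_finite.1 (by omega)).1
    obtain ⟨v⟩ := hconn.nonempty
    obtain ⟨u, hu⟩ := hconn.preconnected.exists_adj_of_nontrivial v
    obtain ⟨e, he⟩ := ((toSimpleGraph_adj_iff v u).1 hu)
    exact ⟨e, he.edge_mem⟩
  obtain ⟨e₀, he₀⟩ := hedge
  obtain ⟨M₀, hM₀, -⟩ := hpm e₀ he₀
  obtain ⟨σ, hσ, -⟩ := h.exists_matchingMap hM₀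
  refine elementary_of_closed biadjacency_subset hσ fun Z hZX hne hcl => ?_
  have hnb : ∀ z ∈ Z, ∀ y, (z, y) ∈ G.biadjacency X Y → y ∈ Z.image σ := by
    intro z hz y hzy
    obtain ⟨u, hu, rfl⟩ := hσ.1.surjOn (mem_biadjacency.1 hzy).2.1
    exact mem_image_of_mem _ (hcl z hz u hu hzy)
  have hback : ∀ x ∈ X, ∀ y ∈ Z.image σ, G.Adj x y → x ∈ Z := by
    rintro x hx y hy ⟨e, he⟩
    obtain ⟨M, hM, heM⟩ := hpm e he.edge_mem
    obtain ⟨τ, hτ, hτM⟩ := h.exists_matchingMap hM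
    have hτx : τ x = y := hτM e heM x hx y he
    have hsub : Z.image τ ⊆ Z.image σ := by
      intro y hy
      obtain ⟨z, hz, rfl⟩ := mem_image.1 hy
      exact hnb z hz _ (hτ.2 z (hZX hz))
    have heq := eq_of_subset_of_card_le hsub (by
      rw [card_image_of_injOn (hτ.1.injOn.mono (by exact_mod_cast hZX))]
      exact card_image_le)
    rw [← heq] at hy
    obtain ⟨z, hz, hzy⟩ := mem_image.1 hy
    rwa [hτ.1.injOn hx (hZX hz) (hτx.trans hzy.symm)]
  have hstep : ∀ u v : V(G), G.toSimpleGraph.Reachable u v → u.1 ∈ Z ∪ Z.image σ →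
      v.1 ∈ Z ∪ Z.image σ := by
    rintro u v ⟨p⟩ hu
    induction p with
    | nil => exact hu
    | @cons u v' _ huv _ ih =>
      refine ih ?_
      rw [toSimpleGraph_adj_iff] at huv
      obtain ⟨e, he⟩ := huv
      rcases mem_union.1 hu with hu | hu
      · exact mem_union_right _ (hnb _ hu _ (h.mem_biadjacency_of_isLink (hZX hu) he))
      · obtain ⟨z, hz, hzu⟩ := mem_image.1 hu
        have huY : u.1 ∈ Y := hzu ▸ hσ.1.mapsTo (hZX hz)
        exact mem_union_left _ (hback _ (h.mem_left_of_isLink huY he) _ hu he.symm.adj)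
  refine hZX.antisymm fun x hx => ?_
  obtain ⟨z, hz⟩ := hne
  rcases mem_union.1 (hstep ⟨z, h.left_mem (hZX hz)⟩ ⟨x, h.left_mem hx⟩
    (hconn.preconnected _ _) (mem_union_left _ hz)) with h1 | h1
  · exact h1
  · obtain ⟨u, hu, hux⟩ := mem_image.1 h1
    have hux : σ u = x := hux
    exact (h.notMem_right hx (hux ▸ hσ.1.mapsTo (hZX hu))).elim

theorem isMatchingCovered_of_elementary (h : G.IsBipartition X Y) (hX : 2 ≤ #X)
    (hel : Elementary X Y (G.biadjacency X Y)) : G.IsMatchingCovered := by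
  have := h.loopless
  obtain ⟨x₀, hx₀⟩ : X.Nonempty := card_pos.1 (by omega)
  refine ⟨?_, ?_, ?_⟩
  · obtain ⟨σ, hσ⟩ := hel.exists_matchingMap ⟨x₀, hx₀⟩
    classical
    let x₀' : V(G) := ⟨x₀, h.left_mem hx₀⟩
    have hadj : ∀ u v : V(G), (u.1, v.1) ∈ G.biadjacency X Y → G.toSimpleGraph.Reachable u v :=
      fun u v huv => ((toSimpleGraph_adj_iff u v).2 (mem_biadjacency.1 huv).2.2).reachable
    -- The left vertices reachable from `x₀` form a closed set, since an arc is an edge followed by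
    -- a matching edge.
    have hZ : (X.filter fun x => ∃ hx : x ∈ V(G), G.toSimpleGraph.Reachable x₀' ⟨x, hx⟩) = X := by
      refine hel.eq_of_closed hσ (filter_subset _ _)
        ⟨x₀, mem_filter.2 ⟨hx₀, h.left_mem hx₀, .refl _⟩⟩ ?_
      intro z hz u hu hzu
      obtain ⟨_, hzV, hz⟩ := mem_filter.1 hz
      have hσu := h.right_mem (hσ.1.mapsTo hu)
      exact mem_filter.2 ⟨hu, h.left_mem hu, (hz.trans (hadj ⟨z, hzV⟩ ⟨σ u, hσu⟩ hzu)).trans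
        (hadj ⟨u, h.left_mem hu⟩ ⟨σ u, hσu⟩ (hσ.2 u hu)).symm⟩
    have hreach : ∀ v : V(G), G.toSimpleGraph.Reachable x₀' v := by
      rintro ⟨v, hv⟩
      rcases h.mem_or hv with hvX | hvY
      · rw [← hZ] at hvX
        exact (mem_filter.1 hvX).2.2
      · obtain ⟨x, hx, rfl⟩ := hσ.1.surjOn hvY
        have hx' := hx
        rw [← hZ] at hx'
        obtain ⟨_, hxV, hr⟩ := mem_filter.1 (mem_coe.1 hx')
        exact hr.trans (hadj ⟨x, hxV⟩ ⟨σ x, hv⟩ (hσ.2 x hx))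
    have : Nonempty V(G) := ⟨x₀'⟩
    exact ⟨fun u v => (hreach u).symm.trans (hreach v)⟩
  · rw [h.ncard_vertexSet, ← hel.card_eq]
    omega
  · intro e he
    obtain ⟨a, ha, b, hb, hab⟩ := h.exists_isLink he
    obtain ⟨σ, hσ, hσa⟩ :=
      hel.exists_matchingMap_apply_eq (h.mem_biadjacency_of_isLink ha hab)
    -- The last clause ensures that `e` itself is used rather than an edge parallel to it; off `X`
    -- the value is irrelevant.
    have hex : ∀ x, ∃ f, x ∈ X → G.IsLink f x (σ x) ∧ (x = a → f = e) := by
      intro x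
      by_cases hx : x ∈ X
      · by_cases hxa : x = a
        · exact ⟨e, fun _ => ⟨by rw [hxa, hσa]; exact hab, fun _ => rfl⟩⟩
        · obtain ⟨f, hf⟩ := (mem_biadjacency.1 (hσ.2 x hx)).2.2
          exact ⟨f, fun _ => ⟨hf, fun hxa' => (hxa hxa').elim⟩⟩
      · exact ⟨e, fun hx' => (hx hx').elim⟩
    choose ε hε using hex
    refine ⟨ε '' X, ⟨⟨?_, ?_, ?_⟩, ?_⟩, ⟨a, ha, (hε a ha).2 rfl⟩⟩
    · rintro _ ⟨x, hx, rfl⟩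
      exact (hε x hx).1.edge_mem
    · exact fun f _ x => G.not_isLoopAt f x
    · rintro _ ⟨x, hx, rfl⟩ _ ⟨z, hz, rfl⟩ u hxu hzu
      have hx := mem_coe.1 hx
      have hz := mem_coe.1 hz
      suffices x = z by rw [this]
      rcases hxu.eq_or_eq_of_isLink (hε x hx).1 with h1 | h1 <;>
        rcases hzu.eq_or_eq_of_isLink (hε z hz).1 with h2 | h2
      · exact h1.symm.trans h2
      · exact (h.notMem_right hx (h1 ▸ h2 ▸ hσ.1.mapsTo hz)).elim
      · exact (h.notMem_right hz (h2 ▸ h1 ▸ hσ.1.mapsTo hx)).elim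
      · exact hσ.1.injOn hx hz (h1.symm.trans h2)
    · intro v hv
      rcases h.mem_or hv with hvX | hvY
      · exact ⟨ε v, ⟨v, hvX, rfl⟩, (hε v hvX).1.inc_left⟩
      · obtain ⟨x, hx, rfl⟩ := hσ.1.surjOn hvY
        exact ⟨ε x, ⟨x, hx, rfl⟩, (hε x hx).1.inc_right⟩

theorem isMatchingCovered_iff (h : G.IsBipartition X Y) :
    G.IsMatchingCovered ↔ 2 ≤ #X ∧ Elementary X Y (G.biadjacency X Y) := by
  refine ⟨fun hG => ?_, fun hG => h.isMatchingCovered_of_elementary hG.1 hG.2⟩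
  have hel := h.elementary_of_isMatchingCovered hG
  have := hG.2.1
  rw [h.ncard_vertexSet, ← hel.card_eq] at this
  exact ⟨by omega, hel⟩

theorem biadjacency_deleteEdges [G.Simple] (h : G.IsBipartition X Y) {e : β} {x y : α}
    (hx : x ∈ X) (he : G.IsLink e x y) :
    (G.deleteEdges {e}).biadjacency X Y = (G.biadjacency X Y).erase (x, y) := by
  have hy := h.mem_right_of_isLink hx he
  ext ⟨u, v⟩
  rw [mem_erase, mem_biadjacency, mem_biadjacency]
  constructor
  · rintro ⟨hu, hv, f, hf, hfe⟩
    refine ⟨fun heq => hfe ?_, hu, hv, f, hf⟩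
    obtain ⟨rfl, rfl⟩ := Prod.mk.inj heq
    exact hf.eq he
  · rintro ⟨hne, hu, hv, f, hf⟩
    refine ⟨hu, hv, f, hf, ?_⟩
    rintro rfl
    rcases hf.eq_and_eq_or_eq_and_eq he with ⟨rfl, rfl⟩ | ⟨rfl, rfl⟩
    · exact hne rfl
    · exact h.notMem_right hu hy

/-- Deleting one of two parallel edges does not change the relation, so minimality forces
simplicity; in a simple graph, deleting an edge removes exactly one pair. -/
theorem isMinimalMatchingCovered_iff (h : G.IsBipartition X Y) :
    G.IsMinimalMatchingCovered ↔
      G.Simple ∧ 2 ≤ #X ∧ MinimalElementary X Y (G.biadjacency X Y) := by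
  rw [IsMinimalMatchingCovered, h.isMatchingCovered_iff]
  constructor
  · rintro ⟨⟨hX, hel⟩, hdel⟩
    have hsimple : G.Simple := by
      have := h.loopless
      refine ⟨fun e f x y he hf => ?_⟩
      by_contra hne
      refine hdel e he.edge_mem ((h.deleteEdges {e}).isMatchingCovered_iff.2 ⟨hX, ?_⟩)
      refine hel.mono ?_ biadjacency_subset
      rintro ⟨u, v⟩ huv
      rw [mem_biadjacency] at huv ⊢
      obtain ⟨hu, hv, g, hg⟩ := huv
      refine ⟨hu, hv, ?_⟩
      by_cases hge : g = e
      · subst hge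
        refine ⟨f, ?_, fun hfg => hne hfg.symm⟩
        rw [he.isLink_iff] at hg
        rwa [hf.isLink_iff]
      · exact ⟨g, hg, hge⟩
    refine ⟨hsimple, hX, hel, ?_⟩
    rintro ⟨x, y⟩ hxy hel'
    obtain ⟨hx, hy, e, he⟩ := mem_biadjacency.1 hxy
    refine hdel e he.edge_mem ((h.deleteEdges {e}).isMatchingCovered_iff.2 ⟨hX, ?_⟩)
    rwa [h.biadjacency_deleteEdges hx he]
  · rintro ⟨hsimple, hX, hel, hmin⟩
    refine ⟨⟨hX, hel⟩, fun e he hcov => ?_⟩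
    obtain ⟨x, hx, y, hy, hxy⟩ := h.exists_isLink he
    have := (h.deleteEdges {e}).elementary_of_isMatchingCovered hcov
    rw [h.biadjacency_deleteEdges hx hxy] at this
    exact hmin _ (h.mem_biadjacency_of_isLink hx hxy) this

omit [DecidableEq α] in
theorem ncard_edgeSet [G.Simple] (h : G.IsBipartition X Y) :
    E(G).ncard = #(G.biadjacency X Y) := by
  rw [← Set.ncard_coe_finset]
  symm
  refine Set.ncard_congr (fun e he => (mem_biadjacency.1 (mem_coe.1 he)).2.2.choose) ?_ ?_ ?_
  · intro e he
    exact (mem_biadjacency.1 (mem_coe.1 he)).2.2.choose_spec.edge_mem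
  · rintro ⟨x, y⟩ ⟨x', y'⟩ he he' heq
    have h1 := (mem_biadjacency.1 (mem_coe.1 he)).2.2.choose_spec
    have h2 := (mem_biadjacency.1 (mem_coe.1 he')).2.2.choose_spec
    dsimp only at heq h1 h2
    rw [heq] at h1
    rcases h1.eq_and_eq_or_eq_and_eq h2 with ⟨rfl, rfl⟩ | ⟨rfl, rfl⟩
    · rfl
    · exact (h.notMem_right (mem_biadjacency.1 (mem_coe.1 he)).1
        (mem_biadjacency.1 (mem_coe.1 he')).2.1).elim
  · intro e he
    obtain ⟨x, hx, y, hy, hxy⟩ := h.exists_isLink he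
    have hmem := h.mem_biadjacency_of_isLink hx hxy
    exact ⟨(x, y), hmem, (mem_biadjacency.1 hmem).2.2.choose_spec.eq hxy⟩

end IsBipartition

theorem IsBipartite.exists_isBipartition (h : G.IsBipartite) (hV : V(G).Finite) :
    ∃ X Y : Finset α, G.IsBipartition X Y := by
  obtain ⟨A, B, hAB, hun, hlink⟩ := h
  have hA : A.Finite := hV.subset (hun ▸ Set.subset_union_left)
  have hB : B.Finite := hV.subset (hun ▸ Set.subset_union_right)
  refine ⟨hA.toFinset, hB.toFinset, ?_, by simpa using hun, fun e x y he => ?_⟩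
  · rwa [← disjoint_coe, hA.coe_toFinset, hB.coe_toFinset]
  · simpa using hlink he

theorem IsBipartition.isBipartite (h : G.IsBipartition X Y) : G.IsBipartite :=
  ⟨X, Y, disjoint_coe.2 h.disjoint, h.union_eq, fun _ _ _ he => h.mem_or_mem he⟩

end Graph

/-! ### Isomorphic leaf matchings of stars as double stars -/

namespace Graph

open BipartiteRelation

variable {α β : Type*} {G : Graph α β}

/-- For simple graphs the bijection of the edges is determined by that of the vertices, so only
adjacency needs to be tracked. -/
theorem isIsomorphic_ofSimpleGraph_iff {W : Type*} {H : SimpleGraph W} :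
    G.IsIsomorphic (ofSimpleGraph H) ↔ G.Simple ∧ ∃ h : W → α, Function.Injective h ∧
      Set.range h = V(G) ∧ ∀ u v, G.Adj (h u) (h v) ↔ H.Adj u v := by
  constructor
  · rintro ⟨f, g, hfg⟩
    have hloopless : G.Loopless := by
      refine ⟨fun e x hex => ?_⟩
      have := (hfg ⟨e, hex.edge_mem⟩ ⟨x, hex.vertex_mem⟩ ⟨x, hex.vertex_mem⟩).1 hex
      obtain ⟨h1, h2⟩ := this
      rw [h1] at h2
      exact H.loopless.irrefl _ h2
    refine ⟨⟨fun e e' x y he he' => ?_⟩, ?_⟩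
    · have h1 := (hfg ⟨e, he.edge_mem⟩ ⟨x, he.left_mem⟩ ⟨y, he.right_mem⟩).1 he
      have h2 := (hfg ⟨e', he'.edge_mem⟩ ⟨x, he.left_mem⟩ ⟨y, he.right_mem⟩).1 he'
      exact congrArg Subtype.val (g.injective (Subtype.ext (h1.1.trans h2.1.symm)))
    · refine ⟨fun u => (f.symm ⟨u, Set.mem_univ u⟩).1, ?_, ?_, ?_⟩
      · intro u v huv
        exact congrArg Subtype.val (f.symm.injective (Subtype.ext huv))
      · ext x
        constructor
        · rintro ⟨u, rfl⟩
          exact (f.symm _).2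
        · intro hx
          exact ⟨(f ⟨x, hx⟩).1, congrArg Subtype.val (f.symm_apply_apply ⟨x, hx⟩)⟩
      · intro u v
        constructor
        · rintro ⟨e, he⟩
          have := (hfg ⟨e, he.edge_mem⟩ _ _).1 he
          rw [f.apply_symm_apply, f.apply_symm_apply] at this
          exact (ofSimpleGraph_adj_iff u v).1 ⟨_, this⟩
        · intro huv
          refine ⟨(g.symm ⟨s(u, v), huv⟩).1, (hfg _ _ _).2 ?_⟩
          rw [f.apply_symm_apply, f.apply_symm_apply, g.apply_symm_apply]
          exact ⟨rfl, huv⟩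
  · rintro ⟨hsimple, h, hinj, hrange, hadj⟩
    let f₀ : W ≃ V(G) := (Equiv.ofInjective h hinj).trans (Equiv.setCongr hrange)
    have hf₀ : ∀ u, (f₀ u).1 = h u := fun u => rfl
    let f : V(G) ≃ V(ofSimpleGraph H) := f₀.symm.trans (Equiv.Set.univ W).symm
    have hends : ∀ e : E(G), ∃ u v, G.IsLink e (h u) (h v) := by
      rintro ⟨e, he⟩
      obtain ⟨x, y, hxy⟩ := exists_isLink_of_mem_edgeSet he
      obtain ⟨u, rfl⟩ := hrange ▸ hxy.left_mem
      obtain ⟨v, rfl⟩ := hrange ▸ hxy.right_mem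
      exact ⟨u, v, hxy⟩
    choose p q hpq using hends
    let g₀ : E(G) → E(ofSimpleGraph H) := fun e =>
      ⟨s(p e, q e), (hadj _ _).1 (hpq e).adj⟩
    have hlink : ∀ (e : E(G)) (u v : W), G.IsLink e (h u) (h v) ↔ (g₀ e).1 = s(u, v) := by
      intro e u v
      rw [(hpq e).isLink_iff_sym2_eq, ← Sym2.map_mk, ← Sym2.map_mk]
      exact (Sym2.map.injective hinj).eq_iff
    have hg₀ : Function.Bijective g₀ := by
      constructor
      · intro e e' hee
        refine Subtype.ext ((hpq e).eq ?_)
        rw [hlink, ← hee]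
      · rintro ⟨s, hs⟩
        induction s with
        | h u v =>
          obtain ⟨e, he⟩ := (hadj u v).2 hs
          exact ⟨⟨e, he.edge_mem⟩, Subtype.ext ((hlink ⟨e, he.edge_mem⟩ u v).1 he)⟩
    refine ⟨f, Equiv.ofBijective g₀ hg₀, fun e x y => ?_⟩
    obtain ⟨u, rfl⟩ := f₀.surjective x
    obtain ⟨v, rfl⟩ := f₀.surjective y
    have hf : ∀ u, (f (f₀ u)).1 = u := fun u =>
      f₀.symm_apply_apply u
    rw [hf₀, hf₀, hlink, hf, hf]
    exact ⟨fun heq => ⟨heq, (g₀ e).2⟩, And.left⟩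

theorem isoLeafMatching_adj_inl_inl {V W : Type*} {T : SimpleGraph V} {T' : SimpleGraph W}
    {φ : T ≃g T'} {u v : V} :
    (T.isoLeafMatching T' φ).Adj (Sum.inl u) (Sum.inl v) ↔ T.Adj u v := by
  simp [SimpleGraph.isoLeafMatching]

theorem isoLeafMatching_adj_inr_inr {V W : Type*} {T : SimpleGraph V} {T' : SimpleGraph W}
    {φ : T ≃g T'} {u v : V} :
    (T.isoLeafMatching T' φ).Adj (Sum.inr (φ u)) (Sum.inr (φ v)) ↔ T.Adj u v := by
  simpa [SimpleGraph.isoLeafMatching] using φ.map_adj_iff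

theorem isoLeafMatching_adj_inl_inr {V W : Type*} {T : SimpleGraph V} {T' : SimpleGraph W}
    {φ : T ≃g T'} {u v : V} :
    (T.isoLeafMatching T' φ).Adj (Sum.inl u) (Sum.inr (φ v)) ↔ T.IsLeaf u ∧ u = v := by
  simp [SimpleGraph.isoLeafMatching, eq_comm]
  grind

/-- The copy `T'` and the isomorphism are absorbed into the labeling `b`, so both copies are labeled
by the vertices of `T`. -/
theorem isObtainedByIsoLeafMatching_iff {V : Type*} {T : SimpleGraph V} :
    G.IsObtainedByIsoLeafMatching T ↔ G.Simple ∧ ∃ a b : V → α,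
      Function.Injective (Sum.elim a b) ∧ Set.range (Sum.elim a b) = V(G) ∧
      (∀ u v, G.Adj (a u) (a v) ↔ T.Adj u v) ∧ (∀ u v, G.Adj (b u) (b v) ↔ T.Adj u v) ∧
      ∀ u v, G.Adj (a u) (b v) ↔ T.IsLeaf u ∧ u = v := by
  constructor
  · rintro ⟨T', φ, hiso⟩
    obtain ⟨hsimple, h, hinj, hrange, hadj⟩ := isIsomorphic_ofSimpleGraph_iff.1 hiso
    have helim : Sum.elim (h ∘ Sum.inl) (fun v => h (Sum.inr (φ v))) =
        h ∘ Equiv.sumCongr (Equiv.refl V) φ.toEquiv := by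
      ext (u | u) <;> rfl
    refine ⟨hsimple, h ∘ Sum.inl, fun v => h (Sum.inr (φ v)), ?_, ?_, fun u v => ?_,
      fun u v => ?_, fun u v => ?_⟩
    · rw [helim]
      exact hinj.comp (Equiv.injective _)
    · rw [helim, EquivLike.range_comp, hrange]
    · exact (hadj _ _).trans isoLeafMatching_adj_inl_inl
    · exact (hadj _ _).trans isoLeafMatching_adj_inr_inr
    · exact (hadj _ _).trans isoLeafMatching_adj_inl_inr
  · rintro ⟨hsimple, a, b, hinj, hrange, haa, hbb, hab⟩
    refine ⟨T, RelIso.refl _, isIsomorphic_ofSimpleGraph_iff.2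
      ⟨hsimple, Sum.elim a b, hinj, hrange, ?_⟩⟩
    rintro (u | u) (v | v)
    · exact (haa u v).trans (isoLeafMatching_adj_inl_inl (φ := .refl)).symm
    · exact (hab u v).trans (isoLeafMatching_adj_inl_inr (φ := .refl)).symm
    · rw [adj_comm, SimpleGraph.adj_comm]
      exact (hab v u).trans (isoLeafMatching_adj_inl_inr (φ := .refl)).symm
    · exact (hbb u v).trans (isoLeafMatching_adj_inr_inr (φ := .refl)).symm

theorem isLeaf_completeBipartiteGraph_inr {p : ℕ} (i : Fin p) :
    (completeBipartiteGraph (Fin 1) (Fin p)).IsLeaf (Sum.inr i) :=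
  ⟨Sum.inl 0, by simp, by rintro (j | j) <;> simp [Fin.fin_one_eq_zero]⟩

theorem not_isLeaf_completeBipartiteGraph_inl {p : ℕ} (hp : 2 ≤ p) (i : Fin 1) :
    ¬ (completeBipartiteGraph (Fin 1) (Fin p)).IsLeaf (Sum.inl i) := by
  intro h
  have := h.unique (y₁ := Sum.inr ⟨0, by omega⟩) (y₂ := Sum.inr ⟨1, by omega⟩) (by simp) (by simp)
  simp at this

variable [DecidableEq α]

theorem IsBipartition.isObtainedByIsoLeafMatching [G.Simple] {X Y : Finset α}
    (h : G.IsBipartition X Y) {c c' : α} {σ : α → α}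
    (hds : IsDoubleStar X Y (G.biadjacency X Y) c c' σ) {p : ℕ} (hp : 2 ≤ p) (hX : #X = p + 1) :
    G.IsObtainedByIsoLeafMatching (completeBipartiteGraph (Fin 1) (Fin p)) := by
  have hcard : #(X.erase c) = p := by rw [card_erase_of_mem hds.left_mem, hX]; rfl
  let l : Fin p → α := fun i => ((X.erase c).equivFinOfCardEq hcard).symm i
  have hl : ∀ i, l i ∈ X ∧ l i ≠ c := fun i =>
    (mem_erase.1 (((X.erase c).equivFinOfCardEq hcard).symm i).2).symm
  have hlinj : Function.Injective l := Subtype.val_injective.comp (Equiv.injective _)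
  have hlsurj : ∀ x ∈ X, x ≠ c → ∃ i, l i = x := fun x hx hxc =>
    ⟨(X.erase c).equivFinOfCardEq hcard ⟨x, mem_erase.2 ⟨hxc, hx⟩⟩, by simp [l]⟩
  have hσl : ∀ i, σ (l i) ∈ Y ∧ σ (l i) ≠ c' := fun i => hds.map_mem (hl i).1 (hl i).2
  have hσinj : ∀ i j, σ (l i) = σ (l j) → i = j := fun i j hij => hlinj
    (hds.bijOn.injOn (mem_coe.2 (mem_erase.2 (hl i).symm)) (mem_coe.2 (mem_erase.2 (hl j).symm)) hij)
  have hadj : ∀ x ∈ X, ∀ y ∈ Y, G.Adj x y ↔ (x = c ∧ y ≠ c') ∨ (x ≠ c ∧ (y = c' ∨ y = σ x)) := by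
    intro x hx y hy
    rw [← hds.mem_iff x hx y hy, mem_biadjacency]
    exact ⟨fun hxy => ⟨hx, hy, hxy⟩, fun hxy => hxy.2.2⟩
  have hXX : ∀ x ∈ X, ∀ y ∈ X, ¬ G.Adj x y := fun x hx y hy ⟨e, he⟩ =>
    h.notMem_right hy (h.mem_right_of_isLink hx he)
  have hYY : ∀ x ∈ Y, ∀ y ∈ Y, ¬ G.Adj x y := fun x hx y hy ⟨e, he⟩ =>
    h.notMem_right (h.mem_left_of_isLink hx he) hy
  have hXY : ∀ x ∈ X, ∀ y ∈ Y, x ≠ y := fun x hx y hy heq => h.notMem_right hx (heq ▸ hy)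
  have hc := hds.left_mem
  have hc' := hds.right_mem
  -- Each star has its center in one class and its leaves in the other: the star at `c` has leaves
  -- `σ (l i)` in `Y`, and the star at `c'` has leaves `l i` in `X`.
  refine isObtainedByIsoLeafMatching_iff.2 ⟨inferInstance, Sum.elim (fun _ => c) (σ ∘ l),
    Sum.elim (fun _ => c') l, ?_, ?_, ?_, ?_, ?_⟩
  · rintro ((i | i) | (i | i)) ((j | j) | (j | j)) hij <;>
      simp only [Sum.elim_inl, Sum.elim_inr, Function.comp] at hij
    · rw [Subsingleton.elim i j]
    · exact (hXY _ hc _ (hσl j).1 hij).elim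
    · exact (hXY _ hc _ hc' hij).elim
    · exact ((hl j).2 hij.symm).elim
    · exact (hXY _ hc _ (hσl i).1 hij.symm).elim
    · rw [hσinj i j hij]
    · exact ((hσl i).2 hij).elim
    · exact (hXY _ (hl j).1 _ (hσl i).1 hij.symm).elim
    · exact (hXY _ hc _ hc' hij.symm).elim
    · exact ((hσl j).2 hij.symm).elim
    · rw [Subsingleton.elim i j]
    · exact (hXY _ (hl j).1 _ hc' hij.symm).elim
    · exact ((hl i).2 hij).elim
    · exact (hXY _ (hl i).1 _ (hσl j).1 hij).elim
    · exact (hXY _ (hl i).1 _ hc' hij).elim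
    · rw [hlinj hij]
  · ext x
    constructor
    · rintro ⟨((i | i) | (i | i)), rfl⟩
      exacts [h.left_mem hc, h.right_mem (hσl i).1, h.right_mem hc', h.left_mem (hl i).1]
    · intro hx
      rcases h.mem_or hx with hx | hx
      · by_cases hxc : x = c
        · exact ⟨Sum.inl (Sum.inl 0), hxc.symm⟩
        · obtain ⟨i, hi⟩ := hlsurj x hx hxc
          exact ⟨Sum.inr (Sum.inr i), hi⟩
      · by_cases hxc : x = c'
        · exact ⟨Sum.inr (Sum.inl 0), hxc.symm⟩
        · obtain ⟨z, hz, rfl⟩ := hds.bijOn.surjOn (mem_coe.2 (mem_erase.2 ⟨hxc, hx⟩))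
          obtain ⟨hzc, hzX⟩ := mem_erase.1 (mem_coe.1 hz)
          obtain ⟨i, rfl⟩ := hlsurj z hzX hzc
          exact ⟨Sum.inl (Sum.inr i), rfl⟩
  · rintro (i | i) (j | j) <;>
      simp only [Sum.elim_inl, Sum.elim_inr, Function.comp, completeBipartiteGraph_adj,
        Sum.isLeft_inl, Sum.isRight_inl, Sum.isLeft_inr, Sum.isRight_inr]
    · simpa using hXX _ hc _ hc
    · simpa using (hadj _ hc _ (hσl j).1).2 (Or.inl ⟨rfl, (hσl j).2⟩)
    · simpa using ((hadj _ hc _ (hσl i).1).2 (Or.inl ⟨rfl, (hσl i).2⟩)).symm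
    · simpa using hYY _ (hσl i).1 _ (hσl j).1
  · rintro (i | i) (j | j) <;>
      simp only [Sum.elim_inl, Sum.elim_inr, completeBipartiteGraph_adj,
        Sum.isLeft_inl, Sum.isRight_inl, Sum.isLeft_inr, Sum.isRight_inr]
    · simpa using hYY _ hc' _ hc'
    · simpa using ((hadj _ (hl j).1 _ hc').2 (Or.inr ⟨(hl j).2, Or.inl rfl⟩)).symm
    · simpa using (hadj _ (hl i).1 _ hc').2 (Or.inr ⟨(hl i).2, Or.inl rfl⟩)
    · simpa using hXX _ (hl i).1 _ (hl j).1
  · rintro (i | i) (j | j) <;> simp only [Sum.elim_inl, Sum.elim_inr, Function.comp]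
    · simp [not_isLeaf_completeBipartiteGraph_inl hp, hadj _ hc _ hc']
    · simpa using hXX _ hc _ (hl j).1
    · simpa using hYY _ (hσl i).1 _ hc'
    · rw [adj_comm, hadj _ (hl j).1 _ (hσl i).1]
      simp only [isLeaf_completeBipartiteGraph_inr, true_and, (hl j).2, (hσl i).2, false_and,
        false_or, not_false_eq_true, ne_eq, Sum.inr.injEq]
      exact ⟨hσinj i j, fun hij => by rw [hij]⟩

theorem IsObtainedByIsoLeafMatching.exists_isDoubleStar {p : ℕ} (hp : 2 ≤ p)
    (h : G.IsObtainedByIsoLeafMatching (completeBipartiteGraph (Fin 1) (Fin p))) :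
    G.Simple ∧ ∃ X Y : Finset α, G.IsBipartition X Y ∧ #X = p + 1 ∧
      ∃ c c' σ, IsDoubleStar X Y (G.biadjacency X Y) c c' σ := by
  obtain ⟨hsimple, a, b, hinj, hrange, haa, hbb, hab⟩ := isObtainedByIsoLeafMatching_iff.1 h
  refine ⟨hsimple, ?_⟩
  have ha : Function.Injective a := hinj.comp Sum.inl_injective
  have hb : Function.Injective b := hinj.comp Sum.inr_injective
  have hne : ∀ u v, a u ≠ b v := fun u v huv => by
    have := @hinj (Sum.inl u) (Sum.inr v) huv
    simp at this
  let c := a (Sum.inl 0)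
  let c' := b (Sum.inl 0)
  let s : Fin p → α := fun i => a (Sum.inr i)
  let t : Fin p → α := fun i => b (Sum.inr i)
  have hs : Function.Injective s := ha.comp Sum.inr_injective
  have ht : Function.Injective t := hb.comp Sum.inr_injective
  have hsc : ∀ i, s i ≠ c := fun i hi => by simpa using ha hi
  have htc : ∀ i, t i ≠ c' := fun i hi => by simpa using hb hi
  have hst : ∀ i j, s i ≠ t j := fun i j => hne _ _
  have hcc : c ≠ c' := hne _ _
  have hct : ∀ i, c ≠ t i := fun i => hne _ _
  have hsc' : ∀ i, s i ≠ c' := fun i => hne _ _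
  have hcs_adj : ∀ i, G.Adj c (s i) := fun i => (haa _ _).2 (by simp)
  have hct_adj : ∀ i, G.Adj (t i) c' := fun i => (hbb _ _).2 (by simp)
  have hst_adj : ∀ i j, G.Adj (t j) (s i) ↔ i = j := fun i j => by
    rw [adj_comm, hab]
    simp [isLeaf_completeBipartiteGraph_inr]
  have hcc_adj : ¬ G.Adj c c' := fun hadj =>
    not_isLeaf_completeBipartiteGraph_inl hp 0 ((hab _ _).1 hadj).1
  have hct_nadj : ∀ i, ¬ G.Adj c (t i) := fun i hadj => by simpa using ((hab _ _).1 hadj).2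
  have hsc_nadj : ∀ i, ¬ G.Adj (s i) c' := fun i hadj => by simpa using ((hab _ _).1 hadj).2
  have hss_nadj : ∀ i j, ¬ G.Adj (s i) (s j) := fun i j hadj => by simpa using (haa _ _).1 hadj
  have htt_nadj : ∀ i j, ¬ G.Adj (t i) (t j) := fun i j hadj => by simpa using (hbb _ _).1 hadj
  have hV : ∀ x, x ∈ V(G) ↔ x = c ∨ (∃ i, x = s i) ∨ x = c' ∨ ∃ i, x = t i := by
    intro x
    rw [← hrange]
    constructor
    · rintro ⟨((i | i) | (i | i)), rfl⟩
      · exact Or.inl (by rw [Subsingleton.elim i 0]; rfl)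
      · exact Or.inr (Or.inl ⟨i, rfl⟩)
      · exact Or.inr (Or.inr (Or.inl (by rw [Subsingleton.elim i 0]; rfl)))
      · exact Or.inr (Or.inr (Or.inr ⟨i, rfl⟩))
    · rintro (rfl | ⟨i, rfl⟩ | rfl | ⟨i, rfl⟩)
      exacts [⟨Sum.inl (Sum.inl 0), rfl⟩, ⟨Sum.inl (Sum.inr i), rfl⟩,
        ⟨Sum.inr (Sum.inl 0), rfl⟩, ⟨Sum.inr (Sum.inr i), rfl⟩]
  clear_value c c' s t
  have hcX : c ∉ univ.image t := fun hmem => by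
    obtain ⟨i, _, hi⟩ := mem_image.1 hmem
    exact hct i hi.symm
  have hcY : c' ∉ univ.image s := fun hmem => by
    obtain ⟨i, _, hi⟩ := mem_image.1 hmem
    exact hsc' i hi
  have hX : ∀ x, x ∈ insert c (univ.image t) ↔ x = c ∨ ∃ i, x = t i := fun x => by
    simp [eq_comm]
  have hY : ∀ x, x ∈ insert c' (univ.image s) ↔ x = c' ∨ ∃ i, x = s i := fun x => by
    simp [eq_comm]
  have hσ : ∀ i, Function.extend t s (fun _ => c') (t i) = s i := fun i => ht.extend_apply _ _ i
  -- Each color class consists of the center of one copy and the leaves of the other.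
  refine ⟨insert c (univ.image t), insert c' (univ.image s), ⟨?_, ?_, ?_⟩, ?_, c, c',
    Function.extend t s (fun _ => c'), mem_insert_self _ _, mem_insert_self _ _, ⟨?_, ?_, ?_⟩,
    biadjacency_subset, ?_⟩
  · rw [disjoint_left]
    intro x hx hy
    rw [hX] at hx
    rw [hY] at hy
    rcases hx with rfl | ⟨i, rfl⟩ <;> rcases hy with hy | ⟨j, hy⟩
    exacts [hcc hy, hsc j hy.symm, htc i hy, hst j i hy.symm]
  · ext x
    rw [hV, Set.mem_union, mem_coe, mem_coe, hX, hY]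
    tauto
  · intro e x y he
    have hadj := he.adj
    have hx := (hV x).1 he.left_mem
    have hy := (hV y).1 he.right_mem
    rw [hX, hX, hY, hY]
    have hnc := G.not_adj_self
    rcases hx with rfl | ⟨i, rfl⟩ | rfl | ⟨i, rfl⟩ <;>
      rcases hy with rfl | ⟨j, rfl⟩ | rfl | ⟨j, rfl⟩
    · exact (hnc _ hadj).elim
    · exact Or.inl ⟨Or.inl rfl, Or.inr ⟨j, rfl⟩⟩
    · exact (hcc_adj hadj).elim
    · exact (hct_nadj j hadj).elim
    · exact Or.inr ⟨Or.inr ⟨i, rfl⟩, Or.inl rfl⟩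
    · exact (hss_nadj i j hadj).elim
    · exact (hsc_nadj i hadj).elim
    · exact Or.inr ⟨Or.inr ⟨i, rfl⟩, Or.inr ⟨j, rfl⟩⟩
    · exact (hcc_adj hadj.symm).elim
    · exact (hsc_nadj j hadj.symm).elim
    · exact (hnc _ hadj).elim
    · exact Or.inr ⟨Or.inl rfl, Or.inr ⟨j, rfl⟩⟩
    · exact (hct_nadj i hadj.symm).elim
    · exact Or.inl ⟨Or.inr ⟨i, rfl⟩, Or.inr ⟨j, rfl⟩⟩
    · exact Or.inl ⟨Or.inr ⟨i, rfl⟩, Or.inl rfl⟩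
    · exact (htt_nadj i j hadj).elim
  · rw [card_insert_of_notMem hcX, card_image_of_injective _ ht, card_univ, Fintype.card_fin]
  all_goals try rw [erase_insert hcX, erase_insert hcY]
  · rintro _ hx
    obtain ⟨i, _, rfl⟩ := mem_image.1 (mem_coe.1 hx)
    rw [hσ]
    exact mem_coe.2 (mem_image_of_mem _ (mem_univ i))
  · rw [erase_insert hcX]
    rintro _ hx _ hy hxy
    obtain ⟨i, _, rfl⟩ := mem_image.1 (mem_coe.1 hx)
    obtain ⟨j, _, rfl⟩ := mem_image.1 (mem_coe.1 hy)
    rw [hσ, hσ] at hxy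
    rw [hs hxy]
  · rintro _ hy
    obtain ⟨i, _, rfl⟩ := mem_image.1 (mem_coe.1 hy)
    exact ⟨t i, mem_coe.2 (mem_image_of_mem _ (mem_univ i)), hσ i⟩
  · intro x hx y hy
    rw [mem_biadjacency, and_iff_right hx, and_iff_right hy]
    rw [hX] at hx
    rw [hY] at hy
    rcases hx with rfl | ⟨i, rfl⟩ <;> rcases hy with rfl | ⟨j, rfl⟩
    · simp [hcc_adj]
    · simp [hcs_adj, hsc']
    · simp [hct_adj, (hct _).symm]
    · simp [hst_adj, (hct _).symm, hsc', hσ, hs.eq_iff]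

end Graph

/-! ### The characterization -/

open BipartiteRelation in
theorem theorem1p5 {α β : Type*} (G : Graph α β) [G.Loopless]
    (hV : V(G).Finite) (hE : E(G).Finite) :
    (G.IsBipartite ∧ G.IsMinimalMatchingCovered ∧ G.IsEdgeExtremal) ↔
      ∃ p : ℕ, 2 ≤ p ∧
        G.IsObtainedByIsoLeafMatching (completeBipartiteGraph (Fin 1) (Fin p)) := by
  classical
  have hext : ∀ {X Y : Finset α} (h : G.IsBipartition X Y) (hs : G.Simple) (hXY : #X = #Y),
      G.IsEdgeExtremal ↔ #(G.biadjacency X Y) + 3 = 3 * #X := by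
    intro X Y h hs hXY
    rw [Graph.IsEdgeExtremal, h.ncard_edgeSet, h.ncard_vertexSet, ← hXY, ← @Nat.cast_inj ℚ]
    push_cast
    constructor <;> intro h <;> linarith
  constructor
  · rintro ⟨hbip, hmin, hextr⟩
    obtain ⟨X, Y, h⟩ := hbip.exists_isBipartition hV
    obtain ⟨hsimple, hX, hel⟩ := h.isMinimalMatchingCovered_iff.1 hmin
    rw [hext h hsimple hel.1.card_eq] at hextr
    -- Two vertices in each class would give the four-cycle, with four edges instead of `3 * 2 - 3`.
    have hX3 : 3 ≤ #X := by
      by_contra hX3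
      have hX2 : #X = 2 := by omega
      rw [hel.1.eq_product_of_card_eq_two hX2, card_product, ← hel.1.card_eq, hX2] at hextr
      omega
    obtain ⟨c, c', σ, hds⟩ := (hel.card_le_and_isDoubleStar hX3).2 hextr
    exact ⟨#X - 1, by omega, h.isObtainedByIsoLeafMatching hds (by omega) (by omega)⟩
  · rintro ⟨p, hp, hG⟩
    obtain ⟨hsimple, X, Y, h, hX, c, c', σ, hds⟩ := hG.exists_isDoubleStar hp
    exact ⟨h.isBipartite, h.isMinimalMatchingCovered_iff.2
      ⟨hsimple, by omega, hds.minimalElementary (by omega)⟩, (hext h hsimple hds.card_eq).2 hds.card⟩
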